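/- Let $(N^{2n+1},\varphi,\xi,\eta,g)$ be a (smooth) Sasakian space form of constant $\varphi$-sectional curvature $c$. That is, $\varphi$ is a $(1,1)$-tensor field, $\xi$ a vector field, $\eta$ a $1$-form and $g$ a Riemannian metric such that $\varphi^2=-I+\eta\otimes\xi$, $\eta(\xi)=1$, $g(\varphi X,\varphi Y)=g(X,Y)-\eta(X)\eta(Y)$ and $g(X,\varphi Y)=d\eta(X,Y)$, where $d\eta(X,Y)=\frac12\big(X\eta(Y)-Y\eta(X)-\eta([X,Y])\big)$; moreover $N_\varphi+2\,d\eta\otimes\xi=0$, where $N_\varphi(X,Y)=[\varphi X,\varphi Y]-\varphi[\varphi X,Y]-\varphi[X,\varphi Y]+\varphi^2[X,Y]$; and the sectional curvature of the plane spanned by $X,\varphi X$ equals $c$ for every unit vector $X\perp\xi$. Let $I\subset\mathbb R$ be a non-empty open interval and let $\gamma:I\to N$ be a Legendre curve ($\eta(\gamma')=0$) parametrized by arc length which is a Frenet curve of osculating order $r\ge 1$: there are smooth orthonormal vector fields $E_1=\gamma'=T,E_2,\dots,E_r$ along $\gamma$ and smooth positive functions $\kappa_1,\dots,\kappa_{r-1}$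 on $I$ with $\nabla_TE_i=-\kappa_{i-1}E_{i-1}+\kappa_iE_{i+1}$ for $1\le i\le r$ (the term with $\kappa_0$ and the term with $\kappa_r$ being omitted), where $\nabla$ is the Levi-Civita connection of $g$. A geodesic is a Frenet curve of osculating order $1$; a circle is a Frenet curve of osculating order $2$ with $\kappa_1$ constant; a helix is a Frenet curve of osculating order $3$ with $\kappa_1,\kappa_2$ constant. The curve $\gamma$ is biharmonic if $\tau_2(\gamma)=\nabla_T^3T-R(T,\nabla_TT)T=0$ on $I$, where $R(X,Y)=\nabla_X\nabla_Y-\nabla_Y\nabla_X-\nabla_{[X,Y]}$, and proper-biharmonic if it is biharmonic and not harmonic, i.e. $\nabla_TT$ is not identically $0$ on $I$. Assume that $c\neq1$ and that $E_2\perp\varphi T$ along $\gamma$ (a condition that is void if $r=1$). 1. If $c\le-3$, then $\gamma$ is biharmonic if and only if it is a geodesic. 2. If $c>-3$, then $\gamma$ is proper-biharmonic if and only if either (a) $n\ge2$ and $\gamma$ is a circle with $\kappa_1^2=\frac{c+3}{4}$, or (b) $n\ge3$ and $\gamma$ is a helix with $\kappa_1^2+\kappa_2^2=\frac{c+3}{4}$.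 -/

import Mathlib

open Bundle
open scoped Manifold ContDiff

noncomputable section

namespace RiemGeom

section Riemannian

variable {E : Type*} [NormedAddCommGroup E] [NormedSpace ℝ E]
  {H : Type*} [TopologicalSpace H] (I : ModelWithCorners ℝ E H)
  {M : Type*} [TopologicalSpace M] [ChartedSpace H M]

variable [IsManifold I 1 M]

/-- The vector field `X` is smooth. -/
def SmoothField (X : Π x : M, TangentSpace I x) : Prop :=
  ContMDiff I I.tangent ∞ (fun x => (⟨x, X x⟩ : TangentBundle I M))

variable [RiemannianBundle (fun x : M => TangentSpace I x)]

/-- The right-hand side `X⟨Y,W⟩ + Y⟨X,W⟩ - W⟨X,Y⟩ + ⟨[X,Y],W⟩ - ⟨[X,W],Y⟩ - ⟨[Y,W],X⟩`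
of the Koszul formula at the point `x`. -/
def koszul (X Y W : Π x : M, TangentSpace I x) (x : M) : ℝ :=
  mvfderiv I (fun y => inner ℝ (Y y) (W y)) x (X x)
    + mvfderiv I (fun y => inner ℝ (X y) (W y)) x (Y x)
    - mvfderiv I (fun y => inner ℝ (X y) (Y y)) x (W x)
    + inner ℝ (VectorField.mlieBracket I X Y x) (W x)
    - inner ℝ (VectorField.mlieBracket I X W x) (Y x)
    - inner ℝ (VectorField.mlieBracket I Y W x) (X x)

variable [FiniteDimensional ℝ E]

instance finiteDimensional_tangentSpace (x : M) :
    FiniteDimensional ℝ (TangentSpace I x) :=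
  inferInstanceAs (FiniteDimensional ℝ E)

/-- The Levi-Civita connection `∇_v Y` at `x`, for a tangent vector `v` at `x`: the vector whose
inner product with `w` is one half of the Koszul expression of `v`, `Y`, `w`, written out in an
orthonormal basis of the tangent space. The vectors `v` and `w` are extended to vector fields which
are constant in the preferred chart at `x`; the Koszul expression does not depend on the
extensions. -/
def leviCivita (Y : Π x : M, TangentSpace I x) (x : M) (v : TangentSpace I x) :
    TangentSpace I x :=
  ∑ i, ((1 / 2 : ℝ) * koszul I (FiberBundle.extend E v) Y
      (FiberBundle.extend E (stdOrthonormalBasis ℝ (TangentSpace I x) i)) x) •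
    stdOrthonormalBasis ℝ (TangentSpace I x) i

/-- The vector field `∇_X Y`. -/
def nabla (X Y : Π x : M, TangentSpace I x) (x : M) : TangentSpace I x :=
  leviCivita I Y x (X x)

/-- The curvature tensor `R(u,v)w = ∇_u ∇_v w - ∇_v ∇_u w - ∇_[u,v] w` at the point `x`, computed
with the extensions of `u`, `v`, `w` that are constant in the preferred chart at `x`. -/
def curvature (x : M) (u v w : TangentSpace I x) : TangentSpace I x :=
  nabla I (FiberBundle.extend E u) (nabla I (FiberBundle.extend E v) (FiberBundle.extend E w)) x
    - nabla I (FiberBundle.extend E v) (nabla I (FiberBundle.extend E u) (FiberBundle.extend E w)) x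
    - nabla I (VectorField.mlieBracket I (FiberBundle.extend E u) (FiberBundle.extend E v))
        (FiberBundle.extend E w) x

/-- The sectional curvature of the plane spanned by the linearly independent vectors `u`, `v`. -/
def sectionalCurvature (x : M) (u v : TangentSpace I x) : ℝ :=
  inner ℝ (curvature I x u v v) u /
    (inner ℝ u u * inner ℝ v v - (inner ℝ u v : ℝ) ^ 2)

/-- The velocity `γ'`. -/
def velocity (γ : ℝ → M) (t : ℝ) : TangentSpace I (γ t) :=
  mfderiv 𝓘(ℝ, ℝ) I γ t (1 : ℝ)

/-- The covariant derivative `∇_T V` at time `t` of a vector field `V` along `γ`. In the coordinate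
frame `(∂_i)` of the preferred chart at `γ t` one has `V = ∑ V^i ∂_i`, and
`∇_T V = ∑ (V^i)' ∂_i + ∑ V^i ∇_{γ'} ∂_i`; the field `∑ V^i(t) ∂_i` is the extension of `V t` which
is constant in this chart. -/
def covDerivAlong (γ : ℝ → M) (V : Π t : ℝ, TangentSpace I (γ t)) (t : ℝ) :
    TangentSpace I (γ t) :=
  (trivializationAt E (TangentSpace I : M → Type _) (γ t)).symm (γ t)
      (deriv (fun s => (trivializationAt E (TangentSpace I : M → Type _) (γ t)
        (⟨γ s, V s⟩ : TangentBundle I M)).2) t)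
    + leviCivita I (FiberBundle.extend E (V t)) (γ t) (velocity I γ t)

/-- The tension field `τ(γ) = ∇_T T` of a curve. -/
def tension (γ : ℝ → M) (t : ℝ) : TangentSpace I (γ t) :=
  covDerivAlong I γ (velocity I γ) t

/-- The bitension field `τ₂(γ) = ∇_T ∇_T τ(γ) - R(T, τ(γ)) T` of a curve. -/
def bitension (γ : ℝ → M) (t : ℝ) : TangentSpace I (γ t) :=
  covDerivAlong I γ (covDerivAlong I γ (tension I γ)) t
    - curvature I (γ t) (velocity I γ t) (tension I γ t) (velocity I γ t)

/-- `γ` is harmonic on the interval `J`. -/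
def IsHarmonic (γ : ℝ → M) (J : Set ℝ) : Prop := ∀ t ∈ J, tension I γ t = 0

/-- `γ` is biharmonic on the interval `J`. -/
def IsBiharmonic (γ : ℝ → M) (J : Set ℝ) : Prop := ∀ t ∈ J, bitension I γ t = 0

/-- `γ` is proper-biharmonic on the interval `J`: biharmonic and not harmonic. -/
def IsProperBiharmonic (γ : ℝ → M) (J : Set ℝ) : Prop :=
  IsBiharmonic I γ J ∧ ¬ IsHarmonic I γ J

/-- On the interval `J`, the curve `γ` is a Frenet curve of osculating order `r`, with Frenet frame
`E₁, …, E_r` and curvatures `κ₁, …, κ_{r-1}` (the values of `e` and `κ` at other indices are not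
used). -/
structure IsFrenetCurve (γ : ℝ → M) (J : Set ℝ) (r : ℕ)
    (e : ℕ → Π t : ℝ, TangentSpace I (γ t)) (κ : ℕ → ℝ → ℝ) : Prop where
  one_le : 1 ≤ r
  le_dim : r ≤ Module.finrank ℝ E
  smooth : ContMDiffOn 𝓘(ℝ, ℝ) I ∞ γ J
  smooth_frame : ∀ i, 1 ≤ i → i ≤ r →
    ContMDiffOn 𝓘(ℝ, ℝ) I.tangent ∞ (fun t => (⟨γ t, e i t⟩ : TangentBundle I M)) J
  smooth_curvature : ∀ i, 1 ≤ i → i < r → ContDiffOn ℝ ∞ (κ i) J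
  curvature_pos : ∀ i, 1 ≤ i → i < r → ∀ t ∈ J, 0 < κ i t
  orthonormal : ∀ t ∈ J, ∀ i j, 1 ≤ i → i ≤ r → 1 ≤ j → j ≤ r →
    inner ℝ (e i t) (e j t) = if i = j then (1 : ℝ) else 0
  first : ∀ t ∈ J, e 1 t = velocity I γ t
  frenet : ∀ t ∈ J, ∀ i, 1 ≤ i → i ≤ r →
    covDerivAlong I γ (e i) t =
      (if 1 < i then -(κ (i - 1) t • e (i - 1) t) else 0)
        + (if i < r then κ i t • e (i + 1) t else 0)

/-- A geodesic is a Frenet curve of osculating order 1. -/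
def IsGeodesic (γ : ℝ → M) (J : Set ℝ) : Prop :=
  ∃ e κ, IsFrenetCurve I γ J 1 e κ

/-- A circle with (constant) curvature `k₁` is a Frenet curve of osculating order 2 with
`κ₁ = k₁`. -/
def IsCircle (γ : ℝ → M) (J : Set ℝ) (k₁ : ℝ) : Prop :=
  ∃ e κ, IsFrenetCurve I γ J 2 e κ ∧ ∀ t ∈ J, κ 1 t = k₁

/-- A helix with (constant) curvatures `k₁`, `k₂` is a Frenet curve of osculating order 3 with
`κ₁ = k₁` and `κ₂ = k₂`. -/
def IsHelix (γ : ℝ → M) (J : Set ℝ) (k₁ k₂ : ℝ) : Prop :=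
  ∃ e κ, IsFrenetCurve I γ J 3 e κ ∧ ∀ t ∈ J, κ 1 t = k₁ ∧ κ 2 t = k₂

end Riemannian

section Sasakian

variable {E : Type*} [NormedAddCommGroup E] [NormedSpace ℝ E]
  {H : Type*} [TopologicalSpace H] (I : ModelWithCorners ℝ E H)
  {M : Type*} [TopologicalSpace M] [ChartedSpace H M]

/-- `dη(X,Y) = ½ (X(η(Y)) - Y(η(X)) - η([X,Y]))`. -/
def extDerivOneForm (η : Π x : M, TangentSpace I x →L[ℝ] ℝ)
    (X Y : Π x : M, TangentSpace I x) (x : M) : ℝ :=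
  (1 / 2 : ℝ) * (mvfderiv I (fun y => η y (Y y)) x (X x)
    - mvfderiv I (fun y => η y (X y)) x (Y x)
    - η x (VectorField.mlieBracket I X Y x))

/-- The Nijenhuis tensor `N_φ(X,Y) = [φX,φY] - φ[φX,Y] - φ[X,φY] + φ²[X,Y]`. -/
def nijenhuis (φ : Π x : M, TangentSpace I x →L[ℝ] TangentSpace I x)
    (X Y : Π x : M, TangentSpace I x) (x : M) : TangentSpace I x :=
  VectorField.mlieBracket I (fun y => φ y (X y)) (fun y => φ y (Y y)) x
    - φ x (VectorField.mlieBracket I (fun y => φ y (X y)) Y x)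
    - φ x (VectorField.mlieBracket I X (fun y => φ y (Y y)) x)
    + φ x (φ x (VectorField.mlieBracket I X Y x))

variable [IsManifold I 1 M] [RiemannianBundle (fun x : M => TangentSpace I x)]

variable (M) in
/-- A contact metric structure `(φ, ξ, η, g)`, where `g` is the given Riemannian metric. -/
structure ContactMetricStructure where
  φ : Π x : M, TangentSpace I x →L[ℝ] TangentSpace I x
  ξ : Π x : M, TangentSpace I x
  η : Π x : M, TangentSpace I x →L[ℝ] ℝ
  smooth_φ : ContMDiff I (I.prod 𝓘(ℝ, E →L[ℝ] E)) ∞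
    (fun x => TotalSpace.mk' (E →L[ℝ] E)
      (E := fun x : M => TangentSpace I x →L[ℝ] TangentSpace I x) x (φ x))
  smooth_ξ : SmoothField I ξ
  smooth_η : ContMDiff I (I.prod 𝓘(ℝ, E →L[ℝ] ℝ)) ∞
    (fun x => TotalSpace.mk' (E →L[ℝ] ℝ)
      (E := fun x : M => TangentSpace I x →L[ℝ] Bundle.Trivial M ℝ x) x (η x))
  φ_φ : ∀ x (v : TangentSpace I x), φ x (φ x v) = -v + η x v • ξ x
  η_ξ : ∀ x, η x (ξ x) = 1
  inner_φ_φ : ∀ x (v w : TangentSpace I x),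
    (inner ℝ (φ x v) (φ x w) : ℝ) = inner ℝ v w - η x v * η x w
  inner_φ : ∀ X Y : (Π x : M, TangentSpace I x), SmoothField I X → SmoothField I Y →
    ∀ x, inner ℝ (X x) (φ x (Y x)) = extDerivOneForm I η X Y x

variable {I}

/-- The contact metric structure is Sasakian, i.e. normal: `N_φ + 2 dη ⊗ ξ = 0`. -/
def ContactMetricStructure.IsSasakian (S : ContactMetricStructure I M) : Prop :=
  ∀ X Y : (Π x : M, TangentSpace I x), SmoothField I X → SmoothField I Y →
    ∀ x, nijenhuis I S.φ X Y x + (2 * extDerivOneForm I S.η X Y x) • S.ξ x = 0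

/-- The curve `γ` is a Legendre curve on the interval `J`, i.e. tangent to the contact
distribution. -/
def ContactMetricStructure.IsLegendre (S : ContactMetricStructure I M) (γ : ℝ → M) (J : Set ℝ) :
    Prop :=
  ∀ t ∈ J, S.η (γ t) (velocity I γ t) = 0

variable [FiniteDimensional ℝ E]

/-- A Sasakian space form of constant `φ`-sectional curvature `c`. -/
def ContactMetricStructure.IsSasakianSpaceForm (S : ContactMetricStructure I M) (c : ℝ) : Prop :=
  S.IsSasakian ∧ ∀ x (u : TangentSpace I x), inner ℝ u u = (1 : ℝ) → inner ℝ u (S.ξ x) = (0 : ℝ) →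
    sectionalCurvature I x u (S.φ x u) = c

end Sasakian

end RiemGeom

end

open RiemGeom

/-! For a Sasakian structure the normality condition and $\Phi = d\eta$ determine $\nabla\varphi$
completely: $(\nabla_X\varphi)Y = g(X,Y)\xi - \eta(Y)X$, and hence $\nabla_X\xi = -\varphi X$.
Differentiating once more gives $R(X,Y)\xi$ and the commutator of $R(X,Y)$ with $\varphi$. Subtract
from $R$, on horizontal vectors, the model tensor with coefficients $(c+3)/4$ and $(c-1)/4$. The
difference has the symmetries of a Kähler curvature tensor and zero holomorphic sectional curvature,
so it vanishes by polarization (`kaehlerForm_eq_zero`). For horizontal $u$ orthogonal to the unit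
Legendre vector $T$ and to $\varphi T$, every $(c-1)$-term drops out and $R(T,u)T = -\frac{c+3}{4}u$
(`curvature_eq_of_sasakianSpaceForm`).

Since $\nabla_TT = \kappa_1E_2$ is horizontal and orthogonal to $T$ and $\varphi T$, the bitension
field is a combination of $E_1,\dots,E_4$ (`IsFrenetCurve.bitension_eq`). Its vanishing means, for
$r\ge2$, that $\kappa_1$ is constant, $\kappa_1^2+\kappa_2^2=\frac{c+3}{4}$, $\kappa_2$ is constant
and $r\le3$. When $c\le-3$ this contradicts $\kappa_1>0$.

The bounds on $n$ come from counting orthonormal vectors: $E_2,T,\varphi T,\xi$ for a circle. For a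
helix, differentiating the known orthogonality relations adds $E_3$ and $\varphi E_2$ to the list
(`IsFrenetCurve.six_le_finrank`).

All tensor calculus is done in one preferred chart, with the metric as a map into bilinear forms and
$\nabla = D + \Gamma$; constant vector fields there commute, which removes the bracket terms. -/

namespace RiemGeom

set_option maxSynthPendingDepth 3

/-! ### Levi-Civita calculus of a metric on an open set of a vector space -/

section LocalMetric

variable {E : Type*} [NormedAddCommGroup E] [NormedSpace ℝ E]

/-- A smooth Riemannian metric on an open subset `U` of a vector space. -/
structure IsLocalMetric (g : E → E →L[ℝ] E →L[ℝ] ℝ) (U : Set E) : Prop where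
  isOpen : IsOpen U
  contDiffOn : ContDiffOn ℝ ∞ g U
  symm : ∀ z ∈ U, ∀ a b, g z a b = g z b a
  pos : ∀ z ∈ U, ∀ a, a ≠ 0 → 0 < g z a a

/-- The Christoffel symbols of the first kind. -/
noncomputable def chrFirst (g : E → E →L[ℝ] E →L[ℝ] ℝ) (z : E) : E →L[ℝ] E →L[ℝ] E →L[ℝ] ℝ :=
  (1 / 2 : ℝ) • (fderiv ℝ g z + (fderiv ℝ g z).flip -
    ((ContinuousLinearMap.flipₗᵢ ℝ E E ℝ).toContinuousLinearEquiv :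
      (E →L[ℝ] E →L[ℝ] ℝ) →L[ℝ] (E →L[ℝ] E →L[ℝ] ℝ)) ∘L
      (fderiv ℝ g z).flip)

lemma chrFirst_apply (g : E → E →L[ℝ] E →L[ℝ] ℝ) (z u v w : E) :
    chrFirst g z u v w =
      (1 / 2 : ℝ) * (fderiv ℝ g z u v w + fderiv ℝ g z v u w - fderiv ℝ g z w u v) := by
  simp [chrFirst]

/-- The Christoffel symbols (of the second kind) of a metric, as a bilinear map. -/
noncomputable def chr (g : E → E →L[ℝ] E →L[ℝ] ℝ) (z : E) : E →L[ℝ] E →L[ℝ] E :=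
  (ContinuousLinearMap.compL ℝ E (E →L[ℝ] ℝ) E (g z).inverse) ∘L chrFirst g z

/-- The curvature tensor of a metric in coordinates. -/
noncomputable def riem (g : E → E →L[ℝ] E →L[ℝ] ℝ) (z u v w : E) : E :=
  fderiv ℝ (chr g) z u v w - fderiv ℝ (chr g) z v u w + chr g z u (chr g z v w)
    - chr g z v (chr g z u w)

namespace IsLocalMetric

variable {g : E → E →L[ℝ] E →L[ℝ] ℝ} {U : Set E} {z : E}

lemma contDiffAt (h : IsLocalMetric g U) (hz : z ∈ U) : ContDiffAt ℝ ∞ g z :=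
  h.contDiffOn.contDiffAt (h.isOpen.mem_nhds hz)

lemma eventually_mem (h : IsLocalMetric g U) (hz : z ∈ U) : ∀ᶠ y in nhds z, y ∈ U :=
  h.isOpen.mem_nhds hz

lemma differentiableAt (h : IsLocalMetric g U) (hz : z ∈ U) : DifferentiableAt ℝ g z :=
  (h.contDiffAt hz).differentiableAt (by simp)

lemma ext_right (h : IsLocalMetric g U) (hz : z ∈ U) {a b : E}
    (hab : ∀ w, g z a w = g z b w) : a = b := by
  by_contra hne
  have := h.pos z hz (a - b) (sub_ne_zero.2 hne)
  simp only [map_sub, sub_apply] at this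
  linarith [hab a, hab b]

lemma fderiv_symm (h : IsLocalMetric g U) (hz : z ∈ U) (u v w : E) :
    fderiv ℝ g z u v w = fderiv ℝ g z u w v := by
  have h1 : (fun y => g y v w) =ᶠ[nhds z] fun y => g y w v := by
    filter_upwards [h.eventually_mem hz] with y hy using h.symm y hy v w
  have hd := h.differentiableAt hz
  have key : ∀ a b : E, fderiv ℝ (fun y => g y a b) z u = fderiv ℝ g z u a b := by
    intro a b
    have := (((hd.hasFDerivAt).clm_apply (hasFDerivAt_const a z)).clm_apply
      (hasFDerivAt_const b z)).fderiv
    rw [this]; simp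
  rw [← key, ← key, h1.fderiv_eq]

variable [FiniteDimensional ℝ E]

lemma isInvertible (h : IsLocalMetric g U) (hz : z ∈ U) : (g z).IsInvertible := by
  have hinj : Function.Injective (g z : E →ₗ[ℝ] (E →L[ℝ] ℝ)) := by
    rw [← LinearMap.ker_eq_bot, LinearMap.ker_eq_bot']
    intro a ha
    by_contra hne
    have := h.pos z hz a hne
    simp only [ContinuousLinearMap.coe_coe] at ha
    rw [ha] at this
    simp at this
  have hfin : Module.finrank ℝ E = Module.finrank ℝ (E →L[ℝ] ℝ) := by
    rw [← LinearEquiv.finrank_eq (LinearMap.toContinuousLinearMap (𝕜 := ℝ) (E := E) (F' := ℝ))]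
    exact (Subspace.dual_finrank_eq (K := ℝ) (V := E)).symm
  refine ⟨(LinearEquiv.ofInjectiveOfFinrankEq (g z : E →ₗ[ℝ] (E →L[ℝ] ℝ)) hinj
    hfin).toContinuousLinearEquiv, ?_⟩
  ext a b
  rfl

lemma apply_chr (h : IsLocalMetric g U) (hz : z ∈ U) (u v w : E) :
    g z (chr g z u v) w =
      (1 / 2 : ℝ) * (fderiv ℝ g z u v w + fderiv ℝ g z v u w - fderiv ℝ g z w u v) := by
  rw [← chrFirst_apply]
  have := (h.isInvertible hz).self_apply_inverse (chrFirst g z u v)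
  simp only [chr, ContinuousLinearMap.comp_apply, ContinuousLinearMap.compL_apply]
  rw [this]

lemma chr_symm (h : IsLocalMetric g U) (hz : z ∈ U) (u v : E) :
    chr g z u v = chr g z v u := by
  refine h.ext_right hz fun w => ?_
  rw [h.apply_chr hz, h.apply_chr hz, h.fderiv_symm hz w u v]
  ring

/-- Metric compatibility, $\nabla g=0$: in the sum of the two Koszul expressions the terms
antisymmetric in `v`, `w` cancel. -/
lemma fderiv_eq (h : IsLocalMetric g U) (hz : z ∈ U) (u v w : E) :
    fderiv ℝ g z u v w = g z (chr g z u v) w + g z v (chr g z u w) := by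
  rw [h.symm z hz v, h.apply_chr hz, h.apply_chr hz, h.fderiv_symm hz u w v]
  ring

/-- Inversion of continuous linear maps is smooth at the invertible map `g z`, and the symbols of
the first kind are built from the derivative of `g`. -/
lemma contDiffAt_chr (h : IsLocalMetric g U) (hz : z ∈ U) : ContDiffAt ℝ ∞ (chr g) z := by
  have h1 : ContDiffAt ℝ ∞ (fderiv ℝ g) z := (h.contDiffAt hz).fderiv_right (by simp)
  have h2 : ContDiffAt ℝ ∞ (fun y => (g y).inverse) z := by
    obtain ⟨e, he⟩ := h.isInvertible hz
    have := contDiffAt_map_inverse (𝕜 := ℝ) (n := ∞) e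
    rw [he] at this
    exact this.comp z (h.contDiffAt hz)
  have hflip : ContDiffAt ℝ ∞ (fun y => (fderiv ℝ g y).flip) z :=
    ((ContinuousLinearMap.flipₗᵢ ℝ E E (E →L[ℝ] ℝ)).toContinuousLinearEquiv.contDiff).contDiffAt.comp
      z h1
  have h3 : ContDiffAt ℝ ∞ (chrFirst g) z := by
    unfold chrFirst
    exact (contDiffAt_const (c := (1 / 2 : ℝ))).smul ((h1.add hflip).sub (contDiffAt_const.clm_comp hflip))
  unfold chr
  exact ((ContinuousLinearMap.contDiff _).contDiffAt.comp z h2).clm_comp h3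

lemma differentiableAt_chr (h : IsLocalMetric g U) (hz : z ∈ U) :
    DifferentiableAt ℝ (chr g) z := (h.contDiffAt_chr hz).differentiableAt (by simp)

omit [FiniteDimensional ℝ E] in
lemma riem_skew (u v w : E) : riem g z u v w = -riem g z v u w := by
  simp only [riem]; abel

lemma fderiv_chr_symm (h : IsLocalMetric g U) (hz : z ∈ U) (u v w : E) :
    fderiv ℝ (chr g) z u v w = fderiv ℝ (chr g) z u w v := by
  have h1 : (fun y => chr g y v w) =ᶠ[nhds z] fun y => chr g y w v := by
    filter_upwards [h.eventually_mem hz] with y hy using h.chr_symm hy v w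
  have hd := h.differentiableAt_chr hz
  have key : ∀ a b : E, fderiv ℝ (fun y => chr g y a b) z u = fderiv ℝ (chr g) z u a b := by
    intro a b
    have := (((hd.hasFDerivAt).clm_apply (hasFDerivAt_const a z)).clm_apply
      (hasFDerivAt_const b z)).fderiv
    rw [this]; simp
  rw [← key, ← key, h1.fderiv_eq]

lemma riem_bianchi (h : IsLocalMetric g U) (hz : z ∈ U) (u v w : E) :
    riem g z u v w + riem g z v w u + riem g z w u v = 0 := by
  simp only [riem]
  rw [h.fderiv_chr_symm hz u v w, h.fderiv_chr_symm hz v w u, h.fderiv_chr_symm hz w u v,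
    h.chr_symm hz v w, h.chr_symm hz u w, h.chr_symm hz u v]
  abel

omit [FiniteDimensional ℝ E] in
lemma fderiv_fderiv_apply (h : IsLocalMetric g U) (hz : z ∈ U) (u v a b : E) :
    fderiv ℝ (fun y => fderiv ℝ g y v a b) z u = fderiv ℝ (fderiv ℝ g) z u v a b := by
  have h1 : DifferentiableAt ℝ (fderiv ℝ g) z :=
    ((h.contDiffAt hz).fderiv_right (m := ∞) (by simp)).differentiableAt (by simp)
  have := ((((h1.hasFDerivAt).clm_apply (hasFDerivAt_const v z)).clm_apply
      (hasFDerivAt_const a z)).clm_apply (hasFDerivAt_const b z)).fderiv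
  rw [this]; simp

/-- Differentiate $\nabla g=0$ a second time: symmetry of the second derivative of `g` turns the
antisymmetrized identity into skewness of the curvature operator. -/
lemma riem_skew_right (h : IsLocalMetric g U) (hz : z ∈ U) (u v a b : E) :
    g z (riem g z u v a) b = -g z a (riem g z u v b) := by
  have hsymm : ∀ u v, fderiv ℝ (fderiv ℝ g) z u v = fderiv ℝ (fderiv ℝ g) z v u := by
    have := (h.contDiffAt hz).isSymmSndFDerivAt (by simpa using ENat.LEInfty.out)
    exact fun u v => this u v
  have hd := (h.differentiableAt hz).hasFDerivAt
  have hc := (h.differentiableAt_chr hz).hasFDerivAt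
  have key : ∀ u v, fderiv ℝ (fderiv ℝ g) z u v a b =
      fderiv ℝ g z u (chr g z v a) b + g z (fderiv ℝ (chr g) z u v a) b
      + fderiv ℝ g z u a (chr g z v b) + g z a (fderiv ℝ (chr g) z u v b) := by
    intro u v
    rw [← h.fderiv_fderiv_apply hz]
    have h1 : (fun y => fderiv ℝ g y v a b) =ᶠ[nhds z]
        fun y => g y (chr g y v a) b + g y a (chr g y v b) := by
      filter_upwards [h.eventually_mem hz] with y hy using h.fderiv_eq hy v a b
    have hca := ((hc.clm_apply (hasFDerivAt_const v z)).clm_apply (hasFDerivAt_const a z))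
    have hcb := ((hc.clm_apply (hasFDerivAt_const v z)).clm_apply (hasFDerivAt_const b z))
    have h2 := (((hd.clm_apply hca).clm_apply (hasFDerivAt_const b z)).add
      ((hd.clm_apply (hasFDerivAt_const a z)).clm_apply hcb)).fderiv
    rw [h1.fderiv_eq]
    erw [h2]
    simp
    ring
  have h1 := key u v
  have h2 := key v u
  rw [hsymm u v, h2] at h1
  simp only [h.fderiv_eq hz] at h1
  simp only [riem, map_add, map_sub, add_apply, sub_apply]
  linarith

end IsLocalMetric

end LocalMetric

/-! ### The covariant derivatives of $\varphi$ and $\xi$ on a Sasakian structure -/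

section LocalSasakian

variable {E : Type*} [NormedAddCommGroup E] [NormedSpace ℝ E]

/-- A Sasakian structure on an open subset `U` of a vector space, in terms of constant vector
fields. -/
structure IsLocalSasakian (g : E → E →L[ℝ] E →L[ℝ] ℝ) (φ : E → E →L[ℝ] E) (ξ : E → E)
    (η : E → E →L[ℝ] ℝ) (U : Set E) : Prop extends IsLocalMetric g U where
  contDiffOn_φ : ContDiffOn ℝ ∞ φ U
  contDiffOn_ξ : ContDiffOn ℝ ∞ ξ U
  contDiffOn_η : ContDiffOn ℝ ∞ η U
  φ_φ : ∀ z ∈ U, ∀ v, φ z (φ z v) = -v + η z v • ξ z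
  η_ξ : ∀ z ∈ U, η z (ξ z) = 1
  g_φ_φ : ∀ z ∈ U, ∀ v w, g z (φ z v) (φ z w) = g z v w - η z v * η z w
  g_φ : ∀ z ∈ U, ∀ u v, g z u (φ z v) = (1 / 2 : ℝ) * (fderiv ℝ η z u v - fderiv ℝ η z v u)
  normal : ∀ z ∈ U, ∀ u v, fderiv ℝ φ z (φ z u) v - fderiv ℝ φ z (φ z v) u
    + φ z (fderiv ℝ φ z v u) - φ z (fderiv ℝ φ z u v) + (2 * g z u (φ z v)) • ξ z = 0

namespace IsLocalSasakian

variable {g : E → E →L[ℝ] E →L[ℝ] ℝ} {φ : E → E →L[ℝ] E} {ξ : E → E} {η : E → E →L[ℝ] ℝ}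
  {U : Set E} {z : E}

lemma contDiffAt_φ (h : IsLocalSasakian g φ ξ η U) (hz : z ∈ U) : ContDiffAt ℝ ∞ φ z :=
  h.contDiffOn_φ.contDiffAt (h.isOpen.mem_nhds hz)

lemma contDiffAt_ξ (h : IsLocalSasakian g φ ξ η U) (hz : z ∈ U) : ContDiffAt ℝ ∞ ξ z :=
  h.contDiffOn_ξ.contDiffAt (h.isOpen.mem_nhds hz)

lemma contDiffAt_η (h : IsLocalSasakian g φ ξ η U) (hz : z ∈ U) : ContDiffAt ℝ ∞ η z :=
  h.contDiffOn_η.contDiffAt (h.isOpen.mem_nhds hz)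

lemma hasFDerivAt_g (h : IsLocalSasakian g φ ξ η U) (hz : z ∈ U) :
    HasFDerivAt g (fderiv ℝ g z) z := (h.differentiableAt hz).hasFDerivAt

lemma hasFDerivAt_φ (h : IsLocalSasakian g φ ξ η U) (hz : z ∈ U) :
    HasFDerivAt φ (fderiv ℝ φ z) z :=
  ((h.contDiffAt_φ hz).differentiableAt (by simp)).hasFDerivAt

lemma hasFDerivAt_ξ (h : IsLocalSasakian g φ ξ η U) (hz : z ∈ U) :
    HasFDerivAt ξ (fderiv ℝ ξ z) z :=
  ((h.contDiffAt_ξ hz).differentiableAt (by simp)).hasFDerivAt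

lemma hasFDerivAt_η (h : IsLocalSasakian g φ ξ η U) (hz : z ∈ U) :
    HasFDerivAt η (fderiv ℝ η z) z :=
  ((h.contDiffAt_η hz).differentiableAt (by simp)).hasFDerivAt

/-- From $\varphi^2\xi=0$, the formula for $\varphi^2$ applied to $\varphi\xi$ gives
$\varphi\xi=a\xi$ with $a=\eta(\varphi\xi)$; then $a\,\varphi\xi=\varphi^2\xi=0$. -/
lemma φ_ξ (h : IsLocalSasakian g φ ξ η U) (hz : z ∈ U) : φ z (ξ z) = 0 := by
  have h1 : φ z (φ z (ξ z)) = 0 := by rw [h.φ_φ z hz, h.η_ξ z hz]; simp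
  have h2 := h.φ_φ z hz (φ z (ξ z))
  rw [h1, map_zero] at h2
  have h3 : φ z (ξ z) = η z (φ z (ξ z)) • ξ z := by
    rw [eq_comm, ← sub_eq_zero, sub_eq_neg_add]; exact h2.symm
  have h4 : η z (φ z (ξ z)) • φ z (ξ z) = 0 := by
    rw [← map_smul, ← h3, h1]
  rcases smul_eq_zero.1 h4 with h5 | h5
  · rw [h3, h5, zero_smul]
  · exact h5

lemma g_ξ (h : IsLocalSasakian g φ ξ η U) (hz : z ∈ U) (v : E) : g z v (ξ z) = η z v := by
  have := h.g_φ_φ z hz v (ξ z)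
  rw [h.φ_ξ hz, map_zero, h.η_ξ z hz] at this
  linarith

lemma g_ξ_left (h : IsLocalSasakian g φ ξ η U) (hz : z ∈ U) (v : E) : g z (ξ z) v = η z v := by
  rw [h.symm z hz, h.g_ξ hz]

lemma g_φ_skew (h : IsLocalSasakian g φ ξ η U) (hz : z ∈ U) (u v : E) :
    g z u (φ z v) = -g z (φ z u) v := by
  rw [h.symm z hz (φ z u), h.g_φ z hz, h.g_φ z hz]; ring

lemma η_φ (h : IsLocalSasakian g φ ξ η U) (hz : z ∈ U) (v : E) : η z (φ z v) = 0 := by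
  rw [← h.g_ξ_left hz, h.g_φ_skew hz, h.φ_ξ hz]; simp

/-- The covariant derivative `(∇_u φ) v`. -/
noncomputable def nablaφ (g : E → E →L[ℝ] E →L[ℝ] ℝ) (φ : E → E →L[ℝ] E) (z u v : E) : E :=
  fderiv ℝ φ z u v + chr g z u (φ z v) - φ z (chr g z u v)

/-- The covariant derivative `∇_u ξ`. -/
noncomputable def nablaξ (g : E → E →L[ℝ] E →L[ℝ] ℝ) (ξ : E → E) (z u : E) : E :=
  fderiv ℝ ξ z u + chr g z u (ξ z)

variable [FiniteDimensional ℝ E]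

/-- The derivative of the fundamental form $\Phi(u,v)=g(u,\varphi v)$, split into its covariant part
and Christoffel terms. -/
lemma fderiv_g_φ (h : IsLocalSasakian g φ ξ η U) (hz : z ∈ U) (x u v : E) :
    fderiv ℝ (fun y => g y u (φ y v)) z x =
      g z u (nablaφ g φ z x v) + g z (chr g z x u) (φ z v) - g z (φ z u) (chr g z x v) := by
  have hφ := (h.hasFDerivAt_φ hz).clm_apply (hasFDerivAt_const v z)
  have := (((h.hasFDerivAt_g hz).clm_apply (hasFDerivAt_const u z)).clm_apply hφ).fderiv
  erw [this]
  have h2 := h.g_φ_skew hz u (chr g z x v)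
  simp [h.fderiv_eq hz, nablaφ]
  linarith

lemma g_nablaφ_skew (h : IsLocalSasakian g φ ξ η U) (hz : z ∈ U) (u v w : E) :
    g z (nablaφ g φ z u v) w = -g z (nablaφ g φ z u w) v := by
  have h1 : (fun y => g y v (φ y w)) =ᶠ[nhds z] fun y => -g y w (φ y v) := by
    filter_upwards [h.eventually_mem hz] with y hy
    rw [h.g_φ_skew hy, h.symm y hy]
  have h2 := congrArg (fun L : E →L[ℝ] ℝ => L u) h1.fderiv_eq
  simp only [fderiv_fun_neg, neg_apply, h.fderiv_g_φ hz] at h2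
  rw [h.symm z hz v, h.symm z hz w, h.symm z hz (φ z w), h.symm z hz (φ z v)] at h2
  linarith

/-- This is $d\Phi=0$, which holds because $\Phi=d\eta$. In the cyclic sum the second derivatives of
`η` cancel by their symmetry and the Christoffel terms because $\Gamma$ is symmetric. -/
lemma g_nablaφ_cyclic (h : IsLocalSasakian g φ ξ η U) (hz : z ∈ U) (u v w : E) :
    g z (nablaφ g φ z u v) w + g z (nablaφ g φ z v w) u + g z (nablaφ g φ z w u) v = 0 := by
  have hd : DifferentiableAt ℝ (fderiv ℝ η) z :=
    ((h.contDiffAt_η hz).fderiv_right (m := ∞) (by simp)).differentiableAt (by simp)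
  have hsymm : ∀ u v, fderiv ℝ (fderiv ℝ η) z u v = fderiv ℝ (fderiv ℝ η) z v u := by
    have := (h.contDiffAt_η hz).isSymmSndFDerivAt (by simpa using ENat.LEInfty.out)
    exact fun u v => this u v
  have key : ∀ x a b : E, g z a (nablaφ g φ z x b) + g z (chr g z x a) (φ z b)
      - g z (φ z a) (chr g z x b) = (1 / 2 : ℝ) * (fderiv ℝ (fderiv ℝ η) z x a b
        - fderiv ℝ (fderiv ℝ η) z x b a) := by
    intro x a b
    rw [← h.fderiv_g_φ hz]
    have h1 : (fun y => g y a (φ y b)) =ᶠ[nhds z]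
        fun y => (1 / 2 : ℝ) * (fderiv ℝ η y a b - fderiv ℝ η y b a) := by
      filter_upwards [h.eventually_mem hz] with y hy using h.g_φ y hy a b
    have ha := (hd.hasFDerivAt.clm_apply (hasFDerivAt_const a z)).clm_apply (hasFDerivAt_const b z)
    have hb := (hd.hasFDerivAt.clm_apply (hasFDerivAt_const b z)).clm_apply (hasFDerivAt_const a z)
    have h2 := ((ha.sub hb).const_mul (1 / 2 : ℝ)).fderiv
    rw [h1.fderiv_eq]
    erw [h2]
    simp
  have k1 := key u w v
  have k2 := key v u w
  have k3 := key w v u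
  rw [h.symm z hz _ (nablaφ _ _ _ _ _), h.symm z hz (φ z _)] at k1 k2 k3
  rw [h.chr_symm hz v u] at k2
  rw [h.chr_symm hz w v, h.chr_symm hz w u] at k3
  rw [hsymm v u] at k2
  rw [hsymm w u, hsymm w v] at k3
  linarith

/-- Since $\nabla$ is torsion-free, the partial derivatives of $\varphi$ in the Nijenhuis tensor may
be replaced by covariant ones. -/
lemma nablaφ_normal (h : IsLocalSasakian g φ ξ η U) (hz : z ∈ U) (u v : E) :
    nablaφ g φ z (φ z u) v - nablaφ g φ z (φ z v) u + φ z (nablaφ g φ z v u)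
      - φ z (nablaφ g φ z u v) + (2 * g z u (φ z v)) • ξ z = 0 := by
  rw [← h.normal z hz u v]
  simp only [nablaφ, map_add, map_sub]
  rw [h.chr_symm hz (φ z v) (φ z u), h.chr_symm hz v u, h.chr_symm hz (φ z v) u,
    h.chr_symm hz (φ z u) v]
  abel

lemma g_nablaξ (h : IsLocalSasakian g φ ξ η U) (hz : z ∈ U) (u v : E) :
    g z (nablaξ g ξ z u) v = fderiv ℝ η z u v - η z (chr g z u v) := by
  have h1 : (fun y => g y (ξ y) v) =ᶠ[nhds z] fun y => η y v := by
    filter_upwards [h.eventually_mem hz] with y hy using h.g_ξ_left hy v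
  have h2 := congrArg (fun L : E →L[ℝ] ℝ => L u) h1.fderiv_eq
  have h3 := (((h.hasFDerivAt_g hz).clm_apply (h.hasFDerivAt_ξ hz)).clm_apply
    (hasFDerivAt_const v z)).fderiv
  have h4 := ((h.hasFDerivAt_η hz).clm_apply (hasFDerivAt_const v z)).fderiv
  erw [h3, h4] at h2
  simp [h.fderiv_eq hz, h.g_ξ_left hz] at h2
  simp [nablaξ]
  linarith

lemma g_nablaξ_ξ (h : IsLocalSasakian g φ ξ η U) (hz : z ∈ U) (u : E) :
    g z (nablaξ g ξ z u) (ξ z) = 0 := by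
  have h1 : (fun y => g y (ξ y) (ξ y)) =ᶠ[nhds z] fun y => 1 := by
    filter_upwards [h.eventually_mem hz] with y hy
    rw [h.g_ξ hy, h.η_ξ y hy]
  have h2 := congrArg (fun L : E →L[ℝ] ℝ => L u) h1.fderiv_eq
  have h3 := (((h.hasFDerivAt_g hz).clm_apply (h.hasFDerivAt_ξ hz)).clm_apply
    (h.hasFDerivAt_ξ hz)).fderiv
  erw [h3] at h2
  simp [h.fderiv_eq hz, h.g_ξ_left hz, h.g_ξ hz] at h2
  simp [nablaξ, h.g_ξ hz]
  linarith

omit [FiniteDimensional ℝ E] in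
lemma nablaφ_ξ (h : IsLocalSasakian g φ ξ η U) (hz : z ∈ U) (u : E) :
    nablaφ g φ z u (ξ z) = -φ z (nablaξ g ξ z u) := by
  have h1 : (fun y => φ y (ξ y)) =ᶠ[nhds z] fun y => 0 := by
    filter_upwards [h.eventually_mem hz] with y hy using h.φ_ξ hy
  have h2 := congrArg (fun L : E →L[ℝ] E => L u) h1.fderiv_eq
  have h3 := ((h.hasFDerivAt_φ hz).clm_apply (h.hasFDerivAt_ξ hz)).fderiv
  erw [h3] at h2
  simp at h2
  simp only [nablaφ, nablaξ, h.φ_ξ hz, map_zero, map_add]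
  rw [eq_neg_of_add_eq_zero_right h2]
  abel

/-- $d\eta(u,\xi)=g(u,\varphi\xi)=0$ gives $g(\nabla_\xi\xi,u)=g(\nabla_u\xi,\xi)$, and the latter
vanishes because $\xi$ has unit length. -/
lemma nablaξ_ξ (h : IsLocalSasakian g φ ξ η U) (hz : z ∈ U) : nablaξ g ξ z (ξ z) = 0 := by
  refine h.ext_right hz fun u => ?_
  have h1 := h.g_φ z hz u (ξ z)
  have h2 := h.g_nablaξ hz u (ξ z)
  have h3 := h.g_nablaξ hz (ξ z) u
  rw [h.g_nablaξ_ξ hz, h.chr_symm hz] at h2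
  rw [h.φ_ξ hz] at h1
  simp at h1 ⊢
  linarith

lemma g_nablaφ_φ (h : IsLocalSasakian g φ ξ η U) (hz : z ∈ U) (v w u : E) :
    g z (nablaφ g φ z (φ z v) w) u = g z v (φ z u) * η z w - g z v (φ z w) * η z u := by
  -- Pair normality with `w` and use $d\Phi=0$ to remove the terms where $\varphi$ is not on the
  -- differentiation direction. With $A(u,v,w)=g((\nabla_{\varphi u}\varphi)v,w)$ this is a
  -- Koszul-type relation: adding two of its cyclic versions isolates $2A(v,w,u)$.
  have key : ∀ u v w : E, g z (nablaφ g φ z (φ z u) v) w + g z (nablaφ g φ z (φ z v) w) u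
      - g z (nablaφ g φ z (φ z w) u) v + 2 * g z u (φ z v) * η z w = 0 := by
    intro u v w
    have h1 := congrArg (fun x => g z x w) (h.nablaφ_normal hz u v)
    simp only [map_add, map_sub, add_apply, sub_apply, map_smul, smul_apply,
      h.g_ξ_left hz, map_zero, zero_apply, smul_eq_mul] at h1
    have h2 := h.g_nablaφ_cyclic hz u v (φ z w)
    have h3 := h.g_nablaφ_skew hz v u (φ z w)
    have h4 := h.g_φ_skew hz (nablaφ g φ z v u) w
    have h5 := h.g_φ_skew hz (nablaφ g φ z u v) w
    have h6 := h.g_nablaφ_skew hz (φ z v) u w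
    linarith
  have k1 := key u v w
  have k2 := key v w u
  have k3 : g z u (φ z v) = -g z v (φ z u) := by rw [h.g_φ_skew hz u v, h.symm z hz]
  linear_combination (k1 + k2) / 2 - η z w * k3

omit [FiniteDimensional ℝ E] in
lemma nablaφ_add_left (x y v : E) :
    nablaφ g φ z (x + y) v = nablaφ g φ z x v + nablaφ g φ z y v := by
  simp only [nablaφ, map_add, add_apply]; abel

omit [FiniteDimensional ℝ E] in
lemma nablaφ_smul_left (r : ℝ) (x v : E) :
    nablaφ g φ z (r • x) v = r • nablaφ g φ z x v := by
  simp only [nablaφ, map_smul, smul_apply, smul_sub, smul_add]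

/-- Writing $u=-\varphi^2u+\eta(u)\xi$ reduces everything to `g_nablaφ_φ` and to the single
direction $\xi$. -/
lemma g_nablaφ_decomp (h : IsLocalSasakian g φ ξ η U) (hz : z ∈ U) (u v w : E) :
    g z (nablaφ g φ z u v) w = g z (φ z u) (φ z v) * η z w - g z (φ z u) (φ z w) * η z v
      + η z u * g z (nablaφ g φ z (ξ z) v) w := by
  have hu : u = (-1 : ℝ) • φ z (φ z u) + η z u • ξ z := by rw [h.φ_φ z hz]; module
  conv_lhs => rw [hu]
  rw [nablaφ_add_left, nablaφ_smul_left, nablaφ_smul_left]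
  simp only [map_add, map_smul, add_apply, smul_apply, smul_eq_mul,
    h.g_nablaφ_φ hz]
  ring

lemma nablaφ_eq (h : IsLocalSasakian g φ ξ η U) (hz : z ∈ U) (u v : E) :
    nablaφ g φ z u v = g z u v • ξ z - η z v • u := by
  have hξξ : ∀ w, g z (nablaφ g φ z (ξ z) (ξ z)) w = 0 := by
    intro w; rw [h.nablaφ_ξ hz, h.nablaξ_ξ hz]; simp
  -- $\nabla_\xi\varphi=0$: in the cyclic identity with first argument $\xi$, the decomposition
  -- evaluates the other two terms to $\pm g(\varphi v,\varphi w)$, and they cancel.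
  have hξ : ∀ v w, g z (nablaφ g φ z (ξ z) v) w = 0 := by
    intro v w
    have h1 := h.g_nablaφ_cyclic hz (ξ z) v w
    have h2 := h.g_nablaφ_decomp hz v w (ξ z)
    have h3 := h.g_nablaφ_decomp hz w (ξ z) v
    rw [h.g_nablaφ_skew hz (ξ z) w (ξ z), hξξ, h.η_ξ z hz, h.φ_ξ hz] at h2
    rw [hξξ, h.η_ξ z hz, h.φ_ξ hz] at h3
    simp at h2 h3
    linarith [h.symm z hz (φ z w) (φ z v)]
  refine h.ext_right hz fun w => ?_
  rw [h.g_nablaφ_decomp hz, hξ, h.g_φ_φ z hz, h.g_φ_φ z hz]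
  simp only [map_sub, map_smul, sub_apply, smul_apply, smul_eq_mul,
    h.g_ξ_left hz]
  ring

/-- Apply $\varphi$ to $-\varphi\nabla_u\xi=(\nabla_u\varphi)\xi=\eta(u)\xi-u$; since
$\nabla_u\xi\perp\xi$, $-\varphi^2$ fixes it. -/
lemma nablaξ_eq (h : IsLocalSasakian g φ ξ η U) (hz : z ∈ U) (u : E) :
    nablaξ g ξ z u = -φ z u := by
  have h1 := h.nablaφ_ξ hz u
  rw [h.nablaφ_eq hz, h.g_ξ hz, h.η_ξ z hz] at h1
  have h2 := congrArg (φ z) h1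
  have h3 := h.g_nablaξ_ξ hz u
  rw [h.g_ξ hz] at h3
  rw [map_neg, h.φ_φ z hz, h3] at h2
  simp [h.φ_ξ hz] at h2
  exact h2.symm

end IsLocalSasakian
end LocalSasakian

/-! ### Curvature identities of a Sasakian structure -/

section LocalSasakian

variable {E : Type*} [NormedAddCommGroup E] [NormedSpace ℝ E] [FiniteDimensional ℝ E]

namespace IsLocalSasakian

variable {g : E → E →L[ℝ] E →L[ℝ] ℝ} {φ : E → E →L[ℝ] E} {ξ : E → E} {η : E → E →L[ℝ] ℝ}
  {U : Set E} {z : E}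

lemma fderiv_φ_apply (h : IsLocalSasakian g φ ξ η U) (hz : z ∈ U) (u v : E) :
    fderiv ℝ φ z u v = g z u v • ξ z - η z v • u - chr g z u (φ z v) + φ z (chr g z u v) := by
  rw [← h.nablaφ_eq hz, nablaφ]; abel

lemma fderiv_ξ_apply (h : IsLocalSasakian g φ ξ η U) (hz : z ∈ U) (u : E) :
    fderiv ℝ ξ z u = -φ z u - chr g z u (ξ z) := by
  rw [← h.nablaξ_eq hz, nablaξ]; abel

lemma fderiv_η_apply (h : IsLocalSasakian g φ ξ η U) (hz : z ∈ U) (u v : E) :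
    fderiv ℝ η z u v = g z u (φ z v) + η z (chr g z u v) := by
  have := h.g_nablaξ hz u v
  rw [h.nablaξ_eq hz] at this
  rw [h.g_φ_skew hz]
  simp at this
  linarith

/-- Differentiate $\nabla_v\xi=-\varphi v$ and antisymmetrize:
$R(u,v)\xi=-(\nabla_u\varphi)v+(\nabla_v\varphi)u$. -/
lemma riem_ξ (h : IsLocalSasakian g φ ξ η U) (hz : z ∈ U) (u v : E) :
    riem g z u v (ξ z) = η z v • u - η z u • v := by
  have hd : DifferentiableAt ℝ (fderiv ℝ ξ) z :=
    ((h.contDiffAt_ξ hz).fderiv_right (m := ∞) (by simp)).differentiableAt (by simp)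
  have hsymm : ∀ u v, fderiv ℝ (fderiv ℝ ξ) z u v = fderiv ℝ (fderiv ℝ ξ) z v u := by
    have := (h.contDiffAt_ξ hz).isSymmSndFDerivAt (by simpa using ENat.LEInfty.out)
    exact fun u v => this u v
  have key : ∀ u v, fderiv ℝ (fderiv ℝ ξ) z u v + fderiv ℝ (chr g) z u v (ξ z)
      + chr g z v (fderiv ℝ ξ z u) = -fderiv ℝ φ z u v := by
    intro u v
    have h1 : (fun y => fderiv ℝ ξ y v + chr g y v (ξ y)) =ᶠ[nhds z] fun y => -φ y v := by
      filter_upwards [h.eventually_mem hz] with y hy using h.nablaξ_eq hy v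
    have h2 := congrArg (fun L : E →L[ℝ] E => L u) h1.fderiv_eq
    have h3 := ((hd.hasFDerivAt.clm_apply (hasFDerivAt_const v z)).add
      (((h.differentiableAt_chr hz).hasFDerivAt.clm_apply (hasFDerivAt_const v z)).clm_apply
      (h.hasFDerivAt_ξ hz))).fderiv
    have h4 := ((h.hasFDerivAt_φ hz).clm_apply (hasFDerivAt_const v z)).neg.fderiv
    erw [h3, h4] at h2
    simp at h2
    rw [← h2]
    abel
  have k1 := key u v
  have k2 := key v u
  rw [hsymm] at k1
  have k3 : riem g z u v (ξ z) = -fderiv ℝ φ z u v + fderiv ℝ φ z v u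
      - chr g z v (fderiv ℝ ξ z u) + chr g z u (fderiv ℝ ξ z v)
      + chr g z u (chr g z v (ξ z)) - chr g z v (chr g z u (ξ z)) := by
    rw [← k1, ← neg_eq_iff_eq_neg.2 k2, riem]; abel
  rw [k3]
  simp only [h.fderiv_φ_apply hz, h.fderiv_ξ_apply hz, map_sub, map_neg, h.chr_symm hz v u,
    h.symm z hz v u]
  abel

/-- The Ricci identity for $\varphi$: antisymmetrizing the derivative of
$(\nabla_v\varphi)w=g(v,w)\xi-\eta(w)v$ yields $[R(u,v),\varphi]w$. -/
lemma riem_φ (h : IsLocalSasakian g φ ξ η U) (hz : z ∈ U) (u v w : E) :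
    riem g z u v (φ z w) = φ z (riem g z u v w) - g z v w • φ z u + g z (φ z u) w • v
      + g z u w • φ z v - g z (φ z v) w • u := by
  have hd : DifferentiableAt ℝ (fderiv ℝ φ) z :=
    ((h.contDiffAt_φ hz).fderiv_right (m := ∞) (by simp)).differentiableAt (by simp)
  have hsymm : ∀ u v, fderiv ℝ (fderiv ℝ φ) z u v = fderiv ℝ (fderiv ℝ φ) z v u := by
    have := (h.contDiffAt_φ hz).isSymmSndFDerivAt (by simpa using ENat.LEInfty.out)
    exact fun u v => this u v
  have key : ∀ u v, fderiv ℝ (fderiv ℝ φ) z u v w + fderiv ℝ (chr g) z u v (φ z w)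
      + chr g z v (fderiv ℝ φ z u w) - φ z (fderiv ℝ (chr g) z u v w)
      - fderiv ℝ φ z u (chr g z v w) =
      fderiv ℝ g z u v w • ξ z + g z v w • fderiv ℝ ξ z u - fderiv ℝ η z u w • v := by
    intro u v
    have h1 : (fun y => fderiv ℝ φ y v w + chr g y v (φ y w) - φ y (chr g y v w)) =ᶠ[nhds z]
        fun y => g y v w • ξ y - η y w • v := by
      filter_upwards [h.eventually_mem hz] with y hy using h.nablaφ_eq hy v w
    have h2 := congrArg (fun L : E →L[ℝ] E => L u) h1.fderiv_eq
    have hc := (h.differentiableAt_chr hz).hasFDerivAt.clm_apply (hasFDerivAt_const v z)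
    have hφ := (h.hasFDerivAt_φ hz).clm_apply (hasFDerivAt_const w z)
    have h3 := ((((hd.hasFDerivAt.clm_apply (hasFDerivAt_const v z)).clm_apply
      (hasFDerivAt_const w z)).add (hc.clm_apply hφ)).sub
      ((h.hasFDerivAt_φ hz).clm_apply (hc.clm_apply (hasFDerivAt_const w z)))).fderiv
    have h4 := (((((h.hasFDerivAt_g hz).clm_apply (hasFDerivAt_const v z)).clm_apply
      (hasFDerivAt_const w z)).smul (h.hasFDerivAt_ξ hz)).sub
      (((h.hasFDerivAt_η hz).clm_apply (hasFDerivAt_const w z)).smul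
        (hasFDerivAt_const v z))).fderiv
    erw [h3, h4] at h2
    simp at h2
    rw [add_comm (fderiv ℝ g z u v w • ξ z), ← h2]
    abel
  have k1 := key u v
  have k2 := key v u
  rw [hsymm] at k1
  have k3 : riem g z u v (φ z w) - φ z (riem g z u v w) =
      (fderiv ℝ g z u v w • ξ z + g z v w • fderiv ℝ ξ z u - fderiv ℝ η z u w • v)
      - (fderiv ℝ g z v u w • ξ z + g z u w • fderiv ℝ ξ z v - fderiv ℝ η z v w • u)
      - chr g z v (fderiv ℝ φ z u w) + fderiv ℝ φ z u (chr g z v w)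
      + chr g z u (fderiv ℝ φ z v w) - fderiv ℝ φ z v (chr g z u w)
      + chr g z u (chr g z v (φ z w)) - chr g z v (chr g z u (φ z w))
      - φ z (chr g z u (chr g z v w)) + φ z (chr g z v (chr g z u w)) := by
    rw [← k1, ← k2]
    simp only [riem, map_add, map_sub]; abel
  rw [← sub_eq_zero]
  have k4 : riem g z u v (φ z w) - (φ z (riem g z u v w) - g z v w • φ z u + g z (φ z u) w • v
      + g z u w • φ z v - g z (φ z v) w • u) = (riem g z u v (φ z w) - φ z (riem g z u v w))
      + g z v w • φ z u - g z (φ z u) w • v - g z u w • φ z v + g z (φ z v) w • u := by abel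
  rw [k4, k3]
  simp only [h.fderiv_φ_apply hz, h.fderiv_ξ_apply hz, h.fderiv_η_apply hz, h.fderiv_eq hz,
    map_sub, map_add, map_smul, h.g_φ_skew hz u, h.g_φ_skew hz v, h.chr_symm hz v u,
    h.symm z hz v (chr g z u w)]
  module

end IsLocalSasakian
end LocalSasakian

/-! ### Algebra of curvature forms -/

section CurvatureAlgebra

/-- The classical octahedron argument: combine the four Bianchi identities obtained by cyclic
rotation of `x, y, z, w` with the two skew-symmetries. -/
lemma curvatureForm_pair_symm {V : Type*} {K : V → V → V → V → ℝ}
    (skew : ∀ x y z w, K x y z w = -K y x z w) (skew' : ∀ x y z w, K x y z w = -K x y w z)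
    (bianchi : ∀ x y z w, K x y z w + K y z x w + K z x y w = 0) (x y z w : V) :
    K x y z w = K z w x y := by
  have b1 := bianchi x y z w
  have b2 := bianchi y z w x
  have b3 := bianchi z w x y
  have b4 := bianchi w x y z
  linarith [skew' y z w x, skew' z w y x, skew w y z x, skew' y w z x, skew' w x z y, skew x z w y,
    skew' z x w y, skew' x y w z, skew y w x z, skew' w y x z, skew z x y w, skew' x z y w,
    skew' z x y w, skew' y z x w, skew w x y z, skew x w y z, skew' x w z y, skew w z x y,
    skew' z w x y]

/-- A Kähler curvature form with vanishing holomorphic sectional curvature vanishes. -/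
lemma kaehlerForm_eq_zero {V : Type*} [AddCommGroup V] {J : V → V} {K : V → V → V → V → ℝ}
    (J_add : ∀ x y, J (x + y) = J x + J y) (J_J : ∀ x, J (J x) = -x)
    (add : ∀ x x' y z w, K (x + x') y z w = K x y z w + K x' y z w)
    (skew : ∀ x y z w, K x y z w = -K y x z w) (skew' : ∀ x y z w, K x y z w = -K x y w z)
    (bianchi : ∀ x y z w, K x y z w + K y z x w + K z x y w = 0)
    (K_J : ∀ x y z w, K x y (J z) (J w) = K x y z w)
    (hol : ∀ x, K x (J x) (J x) x = 0) (x y w : V) : K x y x w = 0 := by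
  have pair := curvatureForm_pair_symm skew skew' bianchi
  have add2 : ∀ x y y' z w, K x (y + y') z w = K x y z w + K x y' z w := by
    intro x y y' z w; rw [skew, add, skew y, skew y']; ring
  have add3 : ∀ x y z z' w, K x y (z + z') w = K x y z w + K x y z' w := by
    intro x y z z' w; rw [pair, add, pair z, pair z']
  have add4 : ∀ x y z w w', K x y z (w + w') = K x y z w + K x y z w' := by
    intro x y z w w'; rw [pair, add2, pair z, pair z]
  have neg1 : ∀ x y z w, K (-x) y z w = -K x y z w := by
    intro x y z w
    have h0 := add 0 0 y z w
    have h1 := add x (-x) y z w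
    rw [add_zero] at h0
    rw [add_neg_cancel] at h1
    linarith
  have neg2 : ∀ x y z w, K x (-y) z w = -K x y z w := by
    intro x y z w; rw [skew, neg1, skew y, neg_neg]
  have neg3 : ∀ x y z w, K x y (-z) w = -K x y z w := by
    intro x y z w; rw [pair, neg1, pair z]
  have neg4 : ∀ x y z w, K x y z (-w) = -K x y z w := by
    intro x y z w; rw [pair, neg2, pair z]
  have J_neg : ∀ x, J (-x) = -J x := by
    intro x
    have h0 := J_add 0 0
    have h1 := J_add x (-x)
    rw [add_zero, left_eq_add] at h0
    rw [add_neg_cancel, h0] at h1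
    exact (neg_eq_of_add_eq_zero_right h1.symm).symm
  have J_K : ∀ x y z w, K (J x) (J y) z w = K x y z w := by
    intro x y z w; rw [pair, K_J, pair z]
  -- Polarization: the sum of the holomorphic curvatures of $x+y$ and $x-y$ keeps the terms
  -- quadratic in `y`. `J`-invariance and pair symmetry leave two kinds of terms, which Bianchi
  -- (`e5`) relates.
  have key : ∀ x y, 3 * K x (J y) x (J y) + K x y x y = 0 := by
    intro x y
    have h1 := hol (x + y)
    have h2 := hol (x + -y)
    simp only [J_add, add, add2, add3, add4, J_neg, neg1, neg2, neg3, neg4, hol] at h1 h2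
    have e1 : K y (J x) (J x) y = K x (J y) (J y) x := by
      rw [← J_K y, ← K_J _ _ (J x), J_J, neg2, neg3, neg_neg, skew, skew']; ring
    have e2 : K x (J y) (J x) y = K x (J y) (J y) x := by
      rw [← K_J _ _ (J x), J_J, neg3, skew']; ring
    have e3 : K y (J x) (J y) x = K x (J y) (J y) x := by rw [pair, skew, skew', e2]; ring
    have e4 : K y (J y) (J x) x = K x (J x) (J y) y := by rw [pair, skew, skew']; ring
    have e5 := bianchi x (J x) (J y) y
    have e6 : K (J x) (J y) x y = K x y x y := J_K _ _ _ _
    have e7 : K (J y) x (J x) y = -K x (J y) (J y) x := by rw [skew, e2]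
    have e8 := skew' x (J y) (J y) x
    linarith
  -- Replacing `y` by `J y` swaps the two terms of `key`, giving a linear system of determinant
  -- $9-1\ne0$.
  have zero : ∀ x y, K x y x y = 0 := by
    intro x y
    have h1 := key x y
    have h2 := key x (J y)
    rw [J_J, neg2, neg4, neg_neg] at h2
    linarith
  have h := zero x (y + w)
  rw [add2, add4, add4, zero, zero, pair x w] at h
  linarith

/-- The curvature of a Sasakian space form on horizontal vectors. -/
lemma curvature_eq_of_sasakianSpaceForm {V : Type*} [NormedAddCommGroup V]
    [InnerProductSpace ℝ V] {φ : V →L[ℝ] V} {ξ : V} {η : V →L[ℝ] ℝ} {R : V → V → V → V} {c : ℝ}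
    (φ_φ : ∀ v, φ (φ v) = -v + η v • ξ) (η_φ : ∀ v, η (φ v) = 0)
    (φ_skew : ∀ u v, inner ℝ (φ u) v = -inner ℝ u (φ v))
    (inner_ξ : ∀ v, inner ℝ v ξ = η v) (η_ξ : η ξ = 1)
    (add : ∀ x x' y z, R (x + x') y z = R x y z + R x' y z)
    (smul : ∀ (a : ℝ) x y z, R (a • x) y z = a • R x y z)
    (skew : ∀ x y z, R x y z = -R y x z)
    (skew' : ∀ x y z w, inner ℝ (R x y z) w = -inner ℝ (R x y w) z)
    (bianchi : ∀ x y z, R x y z + R y z x + R z x y = 0)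
    (R_ξ : ∀ x y, R x y ξ = η y • x - η x • y)
    (R_φ : ∀ x y z, R x y (φ z) = φ (R x y z) - inner ℝ y z • φ x + inner ℝ (φ x) z • y
      + inner ℝ x z • φ y - inner ℝ (φ y) z • x)
    (hc : ∀ u, inner ℝ u u = (1 : ℝ) → inner ℝ u ξ = (0 : ℝ) →
      inner ℝ (R u (φ u) (φ u)) u /
        (inner ℝ u u * inner ℝ (φ u) (φ u) - (inner ℝ u (φ u) : ℝ) ^ 2) = c)
    {T u : V} (hT : inner ℝ T T = (1 : ℝ)) (hηT : η T = 0) (hηu : η u = 0)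
    (huT : inner ℝ u T = (0 : ℝ)) (huφT : inner ℝ u (φ T) = (0 : ℝ)) :
    R T u T = -((c + 3) / 4) • u := by
  have φφ : ∀ v w, (inner ℝ (φ v) (φ w) : ℝ) = inner ℝ v w - η v * η w := by
    intro v w
    rw [φ_skew, φ_φ, inner_add_right, inner_neg_right, inner_smul_right, inner_ξ]; ring
  have self_φ : ∀ v, (inner ℝ v (φ v) : ℝ) = 0 := by
    intro v
    have := φ_skew v v
    rw [real_inner_comm] at this
    linarith
  -- The horizontal vectors, on which $\varphi$ is a complex structure. An additive group suffices,
  -- as `kaehlerForm_eq_zero` never uses homogeneity.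
  let H : AddSubgroup V := (LinearMap.ker (η : V →ₗ[ℝ] ℝ)).toAddSubgroup
  have hH : ∀ v : H, η v = 0 := fun v => v.2
  let J : H → H := fun v => ⟨φ v, η_φ v⟩
  have anti : ∀ a b, (inner ℝ a (φ b) : ℝ) = -inner ℝ b (φ a) := by
    intro a b; rw [← φ_skew, real_inner_comm]
  -- The curvature minus its expected model. The coefficients are forced: the first cancels the
  -- defect of $\varphi$-invariance in `R_φ` together with the second, and on $(x,\varphi x,\varphi
  -- x,x)$ the balance is $c-\frac{c+3}{4}-\frac{3(c-1)}{4}=0$.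
  let K : H → H → H → H → ℝ := fun x y z w => inner ℝ (R x y z) (w : V)
    - (c + 3) / 4 * (inner ℝ (z : V) y * inner ℝ (x : V) w - inner ℝ (z : V) x * inner ℝ (y : V) w)
    + (c - 1) / 4 * (inner ℝ (z : V) (φ y) * inner ℝ (x : V) (φ w)
      - inner ℝ (z : V) (φ x) * inner ℝ (y : V) (φ w)
      + 2 * inner ℝ (x : V) (φ y) * inner ℝ (z : V) (φ w))
  have smul2 : ∀ (a : ℝ) x y z, R x (a • y) z = a • R x y z := by
    intro a x y z; rw [skew, smul, skew y, smul_neg, neg_neg]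
  have pairR : ∀ x y z w, (inner ℝ (R x y z) w : ℝ) = inner ℝ (R z w x) y := by
    refine curvatureForm_pair_symm (fun x y z w => ?_) (fun x y z w => skew' x y z w)
      (fun x y z w => ?_)
    · rw [skew, inner_neg_left]
    · rw [← inner_add_left, ← inner_add_left, bianchi, inner_zero_left]
  have K_zero : ∀ x y w : H, K x y x w = 0 := by
    refine kaehlerForm_eq_zero (J := J) ?_ ?_ ?_ ?_ ?_ ?_ ?_ ?_
    · intro x y; ext; simp [J]
    · intro x; ext; simp [J, φ_φ, hH]
    · intro x x' y z w
      simp only [K, AddSubgroup.coe_add, add, map_add, inner_add_left, inner_add_right]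
      ring
    · intro x y z w
      simp only [K]
      rw [skew, inner_neg_left, anti (y : V) x]
      ring
    · intro x y z w
      simp only [K]
      rw [skew', anti (w : V) y, anti (w : V) x, anti (w : V) z, anti (z : V) y, anti (z : V) x,
        real_inner_comm (y : V) w, real_inner_comm (x : V) w, real_inner_comm (y : V) z,
        real_inner_comm (x : V) z]
      ring
    · intro x y z w
      have h := congrArg (fun v => (inner ℝ v (w : V) : ℝ)) (bianchi x y z)
      simp only [inner_add_left, inner_zero_left] at h
      simp only [K]
      rw [anti (z : V) y, anti (z : V) x, anti (y : V) x, real_inner_comm (y : V) z,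
        real_inner_comm (x : V) z, real_inner_comm (x : V) y]
      linear_combination h
    · intro x y z w
      simp only [K, J]
      rw [R_φ]
      simp only [inner_add_left, inner_sub_left, inner_smul_left, φφ, hH, φ_φ, φ_skew,
        inner_neg_right, inner_add_right, inner_smul_right, map_neg]
      simp only [conj_trivial, zero_smul, add_zero, map_neg, inner_neg_right]
      rw [anti (z : V) y, anti (z : V) x, real_inner_comm (y : V) z, real_inner_comm (x : V) z]
      ring
    · intro x
      simp only [K, J]
      simp only [φ_φ, φφ, hH, zero_smul, add_zero, map_neg, inner_neg_right, φ_skew, self_φ]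
      by_cases hx : (x : V) = 0
      · simp [hx, inner_zero_right]
      have hpos : (0 : ℝ) < ‖(x : V)‖ := norm_pos_iff.2 hx
      have hn : (inner ℝ (x : V) x : ℝ) = ‖(x : V)‖ ^ 2 := real_inner_self_eq_norm_sq _
      -- The hypothesis `hc` concerns unit vectors; normalizing `x` turns it into $\langle
      -- R(x,\varphi x)\varphi x,x\rangle=c\|x\|^4$.
      have h1 : (inner ℝ (‖(x : V)‖⁻¹ • (x : V)) (‖(x : V)‖⁻¹ • (x : V)) : ℝ) = 1 := by
        rw [inner_smul_left, inner_smul_right, hn]; simp; field_simp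
      have h := hc (‖(x : V)‖⁻¹ • (x : V)) h1 (by rw [inner_ξ, map_smul, hH, smul_zero])
      rw [φφ, h1, self_φ, map_smul, map_smul, hH, smul, smul2, inner_smul_left, inner_smul_left,
        skew', inner_smul_right, skew', inner_smul_right] at h
      simp only [conj_trivial, smul_zero, mul_zero, sub_zero, mul_one] at h
      norm_num at h
      rw [hn]
      have h2 : (inner ℝ (R x (φ x) (φ x)) (x : V) : ℝ) = c * ‖(x : V)‖ ^ 4 := by
        rw [← h]; field_simp
      rw [h2]
      ring
  refine ext_inner_right ℝ fun w => ?_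
  have hTu : (inner ℝ T u : ℝ) = 0 := by rw [real_inner_comm, huT]
  have hTφ : (inner ℝ T (φ u) : ℝ) = 0 := by rw [anti, huφT, neg_zero]
  -- Test against horizontal vectors and $\xi$ separately: the horizontal part is covered by
  -- `K_zero`, where $u\perp\varphi T$ removes the $(c-1)$-terms, and the $\xi$-part vanishes by
  -- `R_ξ`.
  have hw : w = (w - η w • ξ) + η w • ξ := by abel
  have h1 := K_zero ⟨T, hηT⟩ ⟨u, hηu⟩ ⟨w - η w • ξ, by
    change η (w - η w • ξ) = 0
    simp [η_ξ]⟩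
  simp only [K] at h1
  rw [hTu, hTφ, hT, self_φ] at h1
  have h2 : (inner ℝ (R T u T) ξ : ℝ) = 0 := by
    rw [skew', R_ξ, hηT, hηu]; simp
  have h3 : (inner ℝ u ξ : ℝ) = 0 := by rw [inner_ξ, hηu]
  rw [hw, inner_add_right, inner_smul_right, h2, inner_smul_left, inner_add_right,
    inner_smul_right, h3]
  simp only [conj_trivial]
  linear_combination h1

end CurvatureAlgebra

/-! ### Vector fields, derivatives and Lie brackets in a chart -/

section Coordinates

variable {E : Type*} [NormedAddCommGroup E] [NormedSpace ℝ E]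
  {H : Type*} [TopologicalSpace H] (I : ModelWithCorners ℝ E H)
  {M : Type*} [TopologicalSpace M] [ChartedSpace H M] [IsManifold I ∞ M]

/-- The components of tangent vectors at `y` in the preferred chart at `p`. -/
noncomputable def toCoord (p y : M) : TangentSpace I y →L[ℝ] E :=
  (trivializationAt E (TangentSpace I : M → Type _) p).continuousLinearMapAt ℝ y

/-- The tangent vector at `y` with given components in the preferred chart at `p`. -/
noncomputable def ofCoord (p y : M) : E →L[ℝ] TangentSpace I y :=
  (trivializationAt E (TangentSpace I : M → Type _) p).symmL ℝ y

/-- The components of a vector field in the preferred chart at `p`. -/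
noncomputable def coordField (p : M) (X : Π x : M, TangentSpace I x) (z : E) : E :=
  toCoord I p ((extChartAt I p).symm z) (X ((extChartAt I p).symm z))

variable {I}
variable {p y : M}

lemma mem_baseSet_of_mem_source (hy : y ∈ (extChartAt I p).source) :
    y ∈ (trivializationAt E (TangentSpace I : M → Type _) p).baseSet := by
  simpa using hy

lemma toCoord_ofCoord (hy : y ∈ (extChartAt I p).source) (a : E) :
    toCoord I p y (ofCoord I p y a) = a :=
  Bundle.Trivialization.continuousLinearMapAt_symmL _ (mem_baseSet_of_mem_source hy) a

lemma ofCoord_toCoord (hy : y ∈ (extChartAt I p).source) (v : TangentSpace I y) :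
    ofCoord I p y (toCoord I p y v) = v :=
  Bundle.Trivialization.symmL_continuousLinearMapAt _ (mem_baseSet_of_mem_source hy) v

lemma toCoord_injective (hy : y ∈ (extChartAt I p).source) {v w : TangentSpace I y}
    (h : toCoord I p y v = toCoord I p y w) : v = w := by
  rw [← ofCoord_toCoord hy v, h, ofCoord_toCoord hy]

lemma snd_trivializationAt_eq_toCoord (hy : y ∈ (extChartAt I p).source) (v : TangentSpace I y) :
    (trivializationAt E (TangentSpace I : M → Type _) p ⟨y, v⟩).2 = toCoord I p y v := by
  rw [toCoord, Bundle.Trivialization.continuousLinearMapAt_apply,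
    Bundle.Trivialization.linearMapAt_apply, if_pos (mem_baseSet_of_mem_source hy)]

/-- Identifies the extensions used in the definitions of connection and curvature with the
coordinate-constant fields, on the whole chart domain and not only at `p`. -/
lemma extend_eq_ofCoord (hy : y ∈ (extChartAt I p).source) (v : TangentSpace I p) :
    FiberBundle.extend E v y = ofCoord I p y (toCoord I p p v) := by
  rw [FiberBundle.extend, ← snd_trivializationAt_eq_toCoord (mem_extChartAt_source p), ofCoord,
    Bundle.Trivialization.symmL_apply _ (mem_baseSet_of_mem_source hy)]

lemma coordField_extChartAt (hy : y ∈ (extChartAt I p).source) (X : Π x : M, TangentSpace I x) :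
    coordField I p X (extChartAt I p y) = toCoord I p y (X y) := by
  rw [coordField, (extChartAt I p).left_inv hy]

lemma toCoord_eq_mfderiv (hy : y ∈ (extChartAt I p).source) (v : TangentSpace I y) :
    toCoord I p y v = mfderiv I 𝓘(ℝ, E) (extChartAt I p) y v := by
  rw [toCoord, TangentBundle.continuousLinearMapAt_trivializationAt (by simpa using hy)]
  rfl

lemma contMDiffAt_ofCoord (hy : y ∈ (extChartAt I p).source) (a : E) :
    ContMDiffAt I I.tangent ∞ (fun x => (⟨x, ofCoord I p x a⟩ : TangentBundle I M)) y := by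
  refine ((trivializationAt E (TangentSpace I : M → Type _) p).contMDiffAt_section_iff
    (mem_baseSet_of_mem_source hy)).2 ?_
  refine (contMDiffAt_const (c := a)).congr_of_eventuallyEq ?_
  filter_upwards [(isOpen_extChartAt_source p).mem_nhds hy] with x hx
  rw [snd_trivializationAt_eq_toCoord hx, toCoord_ofCoord hx]

lemma mdifferentiableAt_ofCoord (hy : y ∈ (extChartAt I p).source) (a : E) :
    MDifferentiableAt I I.tangent (fun x => (⟨x, ofCoord I p x a⟩ : TangentBundle I M)) y :=
  (contMDiffAt_ofCoord hy a).mdifferentiableAt (by simp)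

lemma eventuallyEq_extend (hy : y ∈ (extChartAt I p).source) (w : TangentSpace I p) :
    ∀ᶠ x in nhds y, FiberBundle.extend E w x = ofCoord I p x (toCoord I p p w) := by
  filter_upwards [(isOpen_extChartAt_source p).mem_nhds hy] with x hx using extend_eq_ofCoord hx w

lemma coordField_extend {z : E} (hz : z ∈ (extChartAt I p).target) (w : TangentSpace I p) :
    coordField I p (FiberBundle.extend E w) z = toCoord I p p w := by
  have hs := (extChartAt I p).map_target hz
  rw [coordField, extend_eq_ofCoord hs, toCoord_ofCoord hs]

lemma mdifferentiableAt_extend (hy : y ∈ (extChartAt I p).source) (w : TangentSpace I p) :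
    MDifferentiableAt I I.tangent
      (fun x => (⟨x, FiberBundle.extend E w x⟩ : TangentBundle I M)) y := by
  refine (mdifferentiableAt_ofCoord hy (toCoord I p p w)).congr_of_eventuallyEq ?_
  filter_upwards [eventuallyEq_extend hy w] with x hx
  rw [hx]

variable [I.Boundaryless]

omit [IsManifold I ∞ M] in
lemma mem_nhds_target {z : E} (hz : z ∈ (extChartAt I p).target) :
    (extChartAt I p).target ∈ nhds z := (isOpen_extChartAt_target p).mem_nhds hz

lemma ofCoord_eq_mfderiv (hy : y ∈ (extChartAt I p).source) (a : E) :
    ofCoord I p y a = mfderiv 𝓘(ℝ, E) I (extChartAt I p).symm (extChartAt I p y) a := by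
  rw [ofCoord, TangentBundle.symmL_trivializationAt (by simpa using hy), I.range_eq_univ,
    mfderivWithin_univ]
  rfl

lemma fderiv_coordField_extend {z : E} (hz : z ∈ (extChartAt I p).target) (w : TangentSpace I p) :
    fderiv ℝ (coordField I p (FiberBundle.extend E w)) z = 0 := by
  have h : coordField I p (FiberBundle.extend E w) =ᶠ[nhds z] fun _ => toCoord I p p w := by
    filter_upwards [mem_nhds_target hz] with z hz using coordField_extend hz w
  rw [h.fderiv_eq, fderiv_fun_const, Pi.zero_apply]

lemma contMDiffAt_extChartAt_symm {z : E} (hz : z ∈ (extChartAt I p).target) :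
    ContMDiffAt 𝓘(ℝ, E) I ∞ (extChartAt I p).symm z :=
  (contMDiffOn_extChartAt_symm p).contMDiffAt (mem_nhds_target hz)

lemma contDiffAt_coordField (hy : y ∈ (extChartAt I p).source) {X : Π x : M, TangentSpace I x}
    (hX : ContMDiffAt I I.tangent ∞ (fun x => (⟨x, X x⟩ : TangentBundle I M)) y) :
    ContDiffAt ℝ ∞ (coordField I p X) (extChartAt I p y) := by
  have h1 := ((trivializationAt E (TangentSpace I : M → Type _) p).contMDiffAt_section_iff
    (mem_baseSet_of_mem_source hy)).1 hX
  have hz := (extChartAt I p).map_source hy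
  rw [← contMDiffAt_iff_contDiffAt]
  refine (ContMDiffAt.comp_of_eq h1 (contMDiffAt_extChartAt_symm hz)
    ((extChartAt I p).left_inv hy)).congr_of_eventuallyEq ?_
  filter_upwards [mem_nhds_target hz] with z hz
  exact (snd_trivializationAt_eq_toCoord ((extChartAt I p).map_target hz) _).symm

lemma differentiableAt_coordField (hy : y ∈ (extChartAt I p).source)
    {X : Π x : M, TangentSpace I x}
    (hX : MDifferentiableAt I I.tangent (fun x => (⟨x, X x⟩ : TangentBundle I M)) y) :
    DifferentiableAt ℝ (coordField I p X) (extChartAt I p y) := by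
  have h1 := ((trivializationAt E (TangentSpace I : M → Type _) p).mdifferentiableAt_section_iff I
    X (mem_baseSet_of_mem_source hy)).1 hX
  have hz := (extChartAt I p).map_source hy
  rw [← mdifferentiableAt_iff_differentiableAt]
  refine (MDifferentiableAt.comp_of_eq _ h1
    ((contMDiffAt_extChartAt_symm hz).mdifferentiableAt (by simp))
    ((extChartAt I p).left_inv hy)).congr_of_eventuallyEq ?_
  filter_upwards [mem_nhds_target hz] with z hz
  exact (snd_trivializationAt_eq_toCoord ((extChartAt I p).map_target hz) _).symm

lemma mvfderiv_eq_fderiv {F : Type*} [NormedAddCommGroup F] [NormedSpace ℝ F]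
    (hy : y ∈ (extChartAt I p).source) {f : M → F}
    (hf : MDifferentiableAt I 𝓘(ℝ, F) f y) (v : TangentSpace I y) :
    mvfderiv I f y v = fderiv ℝ (f ∘ (extChartAt I p).symm) (extChartAt I p y)
      (toCoord I p y v) := by
  have hz := (extChartAt I p).map_source hy
  have h1 : MDifferentiableAt 𝓘(ℝ, E) 𝓘(ℝ, F) (f ∘ (extChartAt I p).symm) (extChartAt I p y) :=
    MDifferentiableAt.comp_of_eq _ hf
      ((contMDiffAt_extChartAt_symm hz).mdifferentiableAt (by simp)) ((extChartAt I p).left_inv hy)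
  have h2 := h1.hasMFDerivAt.comp y
    (mdifferentiableAt_extChartAt (I := I) (x := p) (by simpa using hy)).hasMFDerivAt
  have h3 : f =ᶠ[nhds y] (f ∘ (extChartAt I p).symm) ∘ extChartAt I p := by
    filter_upwards [(isOpen_extChartAt_source p).mem_nhds hy] with x hx
    rw [Function.comp_apply, Function.comp_apply, (extChartAt I p).left_inv hx]
  have h4 := (h2.congr_of_eventuallyEq h3).mfderiv
  rw [mfderiv_eq_fderiv] at h4
  rw [toCoord_eq_mfderiv hy]
  exact congrArg (fun L => L v) h4

/-- Brackets are natural under pullback by the inverse chart, and such a pullback is the coordinate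
representation, so the vector space formula applies. -/
lemma toCoord_mlieBracket [CompleteSpace E] (hy : y ∈ (extChartAt I p).source)
    {X Y : Π x : M, TangentSpace I x}
    (hX : MDifferentiableAt I I.tangent (fun x => (⟨x, X x⟩ : TangentBundle I M)) y)
    (hY : MDifferentiableAt I I.tangent (fun x => (⟨x, Y x⟩ : TangentBundle I M)) y) :
    toCoord I p y (VectorField.mlieBracket I X Y y) =
      fderiv ℝ (coordField I p Y) (extChartAt I p y) (toCoord I p y (X y)) -
        fderiv ℝ (coordField I p X) (extChartAt I p y) (toCoord I p y (Y y)) := by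
  have hz := (extChartAt I p).map_source hy
  have hpull : ∀ (Z : Π x : M, TangentSpace I x), ∀ z ∈ (extChartAt I p).target,
      VectorField.mpullback 𝓘(ℝ, E) I (extChartAt I p).symm Z z = coordField I p Z z := by
    intro Z z hz
    have hs := (extChartAt I p).map_target hz
    have h1 : Z ((extChartAt I p).symm z) = mfderiv 𝓘(ℝ, E) I (extChartAt I p).symm z
        (coordField (E := E) I p Z z) := by
      have := ofCoord_eq_mfderiv hs (coordField I p Z z)
      rw [coordField, ofCoord_toCoord hs, (extChartAt I p).right_inv hz] at this
      exact this
    have h2 := isInvertible_mfderivWithin_extChartAt_symm hz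
    rw [I.range_eq_univ, mfderivWithin_univ] at h2
    rw [VectorField.mpullback_apply, h1]
    obtain ⟨e, he⟩ := h2
    rw [← he, ContinuousLinearMap.inverse_equiv]
    exact e.symm_apply_apply _
  have : IsManifold I (minSmoothness ℝ 2) M := by
    rw [minSmoothness_of_isRCLikeNormedField]; infer_instance
  have key := VectorField.mpullback_mlieBracket (I := 𝓘(ℝ, E)) (I' := I)
    (f := (extChartAt I p).symm) (x₀ := extChartAt I p y) (V := X) (W := Y) (n := ∞)
    (by rwa [(extChartAt I p).left_inv hy]) (by rwa [(extChartAt I p).left_inv hy])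
    (contMDiffAt_extChartAt_symm hz) (by simpa using ENat.LEInfty.out)
  rw [hpull _ _ hz, coordField_extChartAt hy] at key
  have hX' := Filter.eventuallyEq_of_mem (mem_nhds_target hz) (hpull X)
  have hY' := Filter.eventuallyEq_of_mem (mem_nhds_target hz) (hpull Y)
  have hb : VectorField.mlieBracket 𝓘(ℝ, E) (coordField I p X) (coordField I p Y) =
      VectorField.lieBracket ℝ (coordField I p X) (coordField I p Y) := by
    exact (VectorField.mlieBracketWithin_univ (I := 𝓘(ℝ, E)) (V := coordField (E := E) I p X)
      (W := coordField (E := E) I p Y)).symm.trans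
      (VectorField.mlieBracketWithin_eq_lieBracketWithin.trans VectorField.lieBracketWithin_univ)
  rw [key, Filter.EventuallyEq.mlieBracket_vectorField_eq hX' hY', hb, VectorField.lieBracket,
    coordField_extChartAt hy, coordField_extChartAt hy]

end Coordinates

/-! ### The Levi-Civita connection and curvature in a chart -/

section LeviCivita

variable {E : Type*} [NormedAddCommGroup E] [NormedSpace ℝ E]
  {H : Type*} [TopologicalSpace H] (I : ModelWithCorners ℝ E H)
  {M : Type*} [TopologicalSpace M] [ChartedSpace H M] [IsManifold I ∞ M]
  [RiemannianBundle (fun x : M => TangentSpace I x)]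

/-- The Riemannian metric in the preferred chart at `p`. -/
noncomputable def coordMetric (p : M) (z : E) : E →L[ℝ] E →L[ℝ] ℝ :=
  (innerSL ℝ (E := TangentSpace I ((extChartAt I p).symm z))).bilinearComp
    (ofCoord I p ((extChartAt I p).symm z)) (ofCoord I p ((extChartAt I p).symm z))

variable {I}
variable {p y : M}

lemma coordMetric_apply (p : M) (z a b : E) : coordMetric I p z a b =
    inner ℝ (ofCoord I p ((extChartAt I p).symm z) a) (ofCoord I p ((extChartAt I p).symm z) b) :=
  rfl

lemma coordMetric_toCoord (hy : y ∈ (extChartAt I p).source) (v w : TangentSpace I y) :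
    coordMetric I p (extChartAt I p y) (toCoord I p y v) (toCoord I p y w) = inner ℝ v w := by
  rw [coordMetric_apply, (extChartAt I p).left_inv hy, ofCoord_toCoord hy, ofCoord_toCoord hy]

lemma inner_comp_symm {z : E} (hz : z ∈ (extChartAt I p).target) (X Y : Π x : M, TangentSpace I x) :
    inner ℝ (X ((extChartAt I p).symm z)) (Y ((extChartAt I p).symm z)) =
      coordMetric I p z (coordField I p X z) (coordField I p Y z) := by
  have hs := (extChartAt I p).map_target hz
  rw [coordMetric_apply, coordField, coordField, ofCoord_toCoord hs, ofCoord_toCoord hs]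

variable [I.Boundaryless] [FiniteDimensional ℝ E]
  [IsContMDiffRiemannianBundle I ∞ E (fun x : M => TangentSpace I x)]

lemma isLocalMetric_coordMetric (p : M) :
    IsLocalMetric (coordMetric I p) (extChartAt I p).target where
  isOpen := isOpen_extChartAt_target p
  contDiffOn := by
    refine contDiffOn_clm_apply.2 fun a => contDiffOn_clm_apply.2 fun b => ?_
    intro z hz
    have hs := (extChartAt I p).map_target hz
    have h1 : ContMDiffAt I 𝓘(ℝ, ℝ) ∞ (fun x => (inner ℝ (ofCoord I p x a) (ofCoord I p x b) : ℝ))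
        ((extChartAt I p).symm z) :=
      ContMDiffAt.inner_bundle (F := E) (E := fun x : M => TangentSpace I x) (IB := I) (b := id)
        (contMDiffAt_ofCoord hs a) (contMDiffAt_ofCoord hs b)
    exact (contMDiffAt_iff_contDiffAt.1
      (h1.comp z (contMDiffAt_extChartAt_symm hz))).contDiffWithinAt
  symm z hz a b := by rw [coordMetric_apply, coordMetric_apply, real_inner_comm]
  pos z hz a ha := by
    rw [coordMetric_apply, real_inner_self_pos]
    intro h
    have := toCoord_ofCoord ((extChartAt I p).map_target hz) a
    rw [h, map_zero] at this
    exact ha this.symm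

/-- The Koszul expression in the preferred chart at `p`. -/
lemma koszul_eq (hy : y ∈ (extChartAt I p).source) {X Y W : Π x : M, TangentSpace I x}
    (hX : MDifferentiableAt I I.tangent (fun x => (⟨x, X x⟩ : TangentBundle I M)) y)
    (hY : MDifferentiableAt I I.tangent (fun x => (⟨x, Y x⟩ : TangentBundle I M)) y)
    (hW : MDifferentiableAt I I.tangent (fun x => (⟨x, W x⟩ : TangentBundle I M)) y) :
    koszul I X Y W y = 2 * coordMetric I p (extChartAt I p y)
      (fderiv ℝ (coordField I p Y) (extChartAt I p y) (toCoord I p y (X y)) +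
        chr (coordMetric I p) (extChartAt I p y) (toCoord I p y (X y)) (toCoord I p y (Y y)))
      (toCoord I p y (W y)) := by
  have hz := (extChartAt I p).map_source hy
  have hg := isLocalMetric_coordMetric (I := I) p
  have hd : ∀ {X Y : Π x : M, TangentSpace I x},
      MDifferentiableAt I I.tangent (fun x => (⟨x, X x⟩ : TangentBundle I M)) y →
      MDifferentiableAt I I.tangent (fun x => (⟨x, Y x⟩ : TangentBundle I M)) y →
      ∀ v : TangentSpace I y, mvfderiv I (fun x => (inner ℝ (X x) (Y x) : ℝ)) y v =
        fderiv ℝ (coordMetric I p) (extChartAt I p y) (toCoord I p y v) (toCoord I p y (X y))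
          (toCoord I p y (Y y))
        + coordMetric I p (extChartAt I p y) (fderiv ℝ (coordField I p X) (extChartAt I p y)
          (toCoord I p y v)) (toCoord I p y (Y y))
        + coordMetric I p (extChartAt I p y) (toCoord I p y (X y))
          (fderiv ℝ (coordField I p Y) (extChartAt I p y) (toCoord I p y v)) := by
    intro X Y hX hY v
    have h1 : MDifferentiableAt I 𝓘(ℝ, ℝ) (fun x => (inner ℝ (X x) (Y x) : ℝ)) y :=
      MDifferentiableAt.inner_bundle (F := E) (E := fun x : M => TangentSpace I x) (IB := I)
        (b := id) hX hY
    have h2 : (fun x => (inner ℝ (X x) (Y x) : ℝ)) ∘ (extChartAt I p).symm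
        =ᶠ[nhds (extChartAt I p y)]
        fun z => coordMetric I p z (coordField I p X z) (coordField I p Y z) := by
      filter_upwards [mem_nhds_target hz] with z hz using inner_comp_symm hz X Y
    have h3 := (((hg.differentiableAt hz).hasFDerivAt.clm_apply
      (differentiableAt_coordField hy hX).hasFDerivAt).clm_apply
      (differentiableAt_coordField hy hY).hasFDerivAt).fderiv
    rw [mvfderiv_eq_fderiv hy h1, h2.fderiv_eq]
    erw [h3]
    simp only [coordField_extChartAt hy, add_apply, ContinuousLinearMap.comp_apply,
      ContinuousLinearMap.flip_apply]
    ring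
  rw [koszul, hd hY hW, hd hX hW, hd hX hY]
  rw [← coordMetric_toCoord hy (VectorField.mlieBracket I X Y y),
    ← coordMetric_toCoord hy (VectorField.mlieBracket I X W y),
    ← coordMetric_toCoord hy (VectorField.mlieBracket I Y W y), toCoord_mlieBracket hy hX hY,
    toCoord_mlieBracket hy hX hW, toCoord_mlieBracket hy hY hW, map_add, add_apply,
    hg.apply_chr hz]
  simp only [map_sub, sub_apply]
  rw [hg.symm _ hz (toCoord I p y (X y)) (fderiv ℝ (coordField I p W) _ _),
    hg.symm _ hz (toCoord I p y (Y y)) (fderiv ℝ (coordField I p W) _ _),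
    hg.symm _ hz (toCoord I p y (X y)) (fderiv ℝ (coordField I p Y) _ _)]
  ring

/-- By `koszul_eq` the Koszul expression sees only the values of its first and third fields at `y`.
Thus, although `leviCivita` extends vectors with the chart at `y`, the chart at `p` may be used,
which iterated derivatives near `p` require. -/
lemma toCoord_leviCivita (hy : y ∈ (extChartAt I p).source) {Y : Π x : M, TangentSpace I x}
    (hY : MDifferentiableAt I I.tangent (fun x => (⟨x, Y x⟩ : TangentBundle I M)) y)
    (v : TangentSpace I y) :
    toCoord I p y (leviCivita I Y y v) =
      fderiv ℝ (coordField I p Y) (extChartAt I p y) (toCoord I p y v) +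
        chr (coordMetric I p) (extChartAt I p y) (toCoord I p y v) (toCoord I p y (Y y)) := by
  set a := fderiv ℝ (coordField I p Y) (extChartAt I p y) (toCoord I p y v) +
        chr (coordMetric I p) (extChartAt I p y) (toCoord I p y v) (toCoord I p y (Y y)) with ha
  have h1 : leviCivita I Y y v = ofCoord I p y a := by
    rw [leviCivita, ← (stdOrthonormalBasis ℝ (TangentSpace I y)).sum_repr (ofCoord I p y a)]
    refine Finset.sum_congr rfl fun i _ => ?_
    rw [koszul_eq hy (FiberBundle.mdifferentiableAt_extend I E v) hY
      (FiberBundle.mdifferentiableAt_extend I E _), FiberBundle.extend_apply_self,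
      FiberBundle.extend_apply_self, ← ha, OrthonormalBasis.repr_apply_apply, real_inner_comm,
      ← coordMetric_toCoord hy, toCoord_ofCoord hy]
    congr 1
    ring
  rw [h1, toCoord_ofCoord hy]

lemma toCoord_nabla_extend (hy : y ∈ (extChartAt I p).source) (X : Π x : M, TangentSpace I x)
    (w : TangentSpace I p) :
    toCoord I p y (nabla I X (FiberBundle.extend E w) y) =
      chr (coordMetric I p) (extChartAt I p y) (toCoord I p y (X y)) (toCoord I p p w) := by
  have hz := (extChartAt I p).map_source hy
  rw [nabla, toCoord_leviCivita hy (mdifferentiableAt_extend hy w), fderiv_coordField_extend hz,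
    extend_eq_ofCoord hy, toCoord_ofCoord hy, zero_apply, zero_add]

lemma toCoord_nabla_nabla_extend (u v w : TangentSpace I p) :
    toCoord I p p (nabla I (FiberBundle.extend E u)
      (nabla I (FiberBundle.extend E v) (FiberBundle.extend E w)) p) =
      fderiv ℝ (chr (coordMetric I p)) (extChartAt I p p) (toCoord I p p u) (toCoord I p p v)
        (toCoord I p p w)
      + chr (coordMetric I p) (extChartAt I p p) (toCoord I p p u)
        (chr (coordMetric I p) (extChartAt I p p) (toCoord I p p v) (toCoord I p p w)) := by
  have hp := mem_extChartAt_source (I := I) p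
  have hz := mem_extChartAt_target (I := I) p
  have hg := isLocalMetric_coordMetric (I := I) p
  have hd := (((hg.differentiableAt_chr hz).hasFDerivAt.clm_apply
    (hasFDerivAt_const (toCoord I p p v) _)).clm_apply (hasFDerivAt_const (toCoord I p p w) _))
  have hZ : ∀ x ∈ (extChartAt I p).source, toCoord I p x
      (nabla I (FiberBundle.extend E v) (FiberBundle.extend E w) x) =
        chr (coordMetric I p) (extChartAt I p x) (toCoord I p p v) (toCoord I p p w) := by
    intro x hx
    rw [toCoord_nabla_extend hx, extend_eq_ofCoord hx, toCoord_ofCoord hx]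
  have h1 : coordField I p (nabla I (FiberBundle.extend E v) (FiberBundle.extend E w))
      =ᶠ[nhds (extChartAt I p p)]
      fun z => chr (coordMetric I p) z (toCoord I p p v) (toCoord I p p w) := by
    filter_upwards [mem_nhds_target hz] with z hz
    rw [coordField, hZ _ ((extChartAt I p).map_target hz), (extChartAt I p).right_inv hz]
  -- The inner covariant derivative must be a differentiable section before the coordinate formula
  -- can be applied to it; its components are $\Gamma(v,w)$.
  have h2 : MDifferentiableAt I I.tangent (fun x => (⟨x,
      nabla I (FiberBundle.extend E v) (FiberBundle.extend E w) x⟩ : TangentBundle I M)) p := by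
    refine ((trivializationAt E (TangentSpace I : M → Type _) p).mdifferentiableAt_section_iff I
      _ (mem_baseSet_of_mem_source hp)).2 ?_
    refine ((hd.differentiableAt.mdifferentiableAt).comp p (mdifferentiableAt_extChartAt (I := I)
      (x := p) (by simp))).congr_of_eventuallyEq ?_
    filter_upwards [(isOpen_extChartAt_source p).mem_nhds hp] with x hx
    rw [snd_trivializationAt_eq_toCoord hx, hZ x hx]
    rfl
  rw [nabla, toCoord_leviCivita hp h2, h1.fderiv_eq, hZ p hp, FiberBundle.extend_apply_self]
  erw [hd.fderiv]
  simp only [add_apply, ContinuousLinearMap.comp_apply, ContinuousLinearMap.flip_apply,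
    zero_apply, map_zero, zero_add]

/-- The fields involved are constant in the chart, so their bracket vanishes and only derivatives
and products of $\Gamma$ remain. -/
lemma toCoord_curvature (u v w : TangentSpace I p) :
    toCoord I p p (curvature I p u v w) = riem (coordMetric I p) (extChartAt I p p)
      (toCoord I p p u) (toCoord I p p v) (toCoord I p p w) := by
  have hp := mem_extChartAt_source (I := I) p
  have hz := mem_extChartAt_target (I := I) p
  rw [curvature, map_sub, map_sub, toCoord_nabla_nabla_extend, toCoord_nabla_nabla_extend,
    toCoord_nabla_extend hp, toCoord_mlieBracket hp (mdifferentiableAt_extend hp u)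
      (mdifferentiableAt_extend hp v), fderiv_coordField_extend hz, fderiv_coordField_extend hz,
    riem]
  simp only [zero_apply, sub_zero, map_zero]
  abel

end LeviCivita

/-! ### Covariant differentiation along a curve -/

section Curves

variable {E : Type*} [NormedAddCommGroup E] [NormedSpace ℝ E]
  {H : Type*} [TopologicalSpace H] {I : ModelWithCorners ℝ E H}
  {M : Type*} [TopologicalSpace M] [ChartedSpace H M] [IsManifold I ∞ M]
  {γ : ℝ → M} {t : ℝ} {V W : Π t : ℝ, TangentSpace I (γ t)}

variable (I) in
/-- The vector field `V` along `γ` is differentiable at `t`. -/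
def DiffAlongAt (γ : ℝ → M) (V : Π t : ℝ, TangentSpace I (γ t)) (t : ℝ) : Prop :=
  MDifferentiableAt 𝓘(ℝ, ℝ) I.tangent (fun s => (⟨γ s, V s⟩ : TangentBundle I M)) t

lemma DiffAlongAt.base (h : DiffAlongAt I γ V t) : MDifferentiableAt 𝓘(ℝ, ℝ) I γ t :=
  ((mdifferentiableAt_totalSpace I _).1 h).1

omit [IsManifold I ∞ M] in
lemma eventually_mem_source (hγ : MDifferentiableAt 𝓘(ℝ, ℝ) I γ t) :
    ∀ᶠ s in nhds t, γ s ∈ (extChartAt I (γ t)).source :=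
  hγ.continuousAt (extChartAt_source_mem_nhds (γ t))

lemma snd_eventuallyEq_toCoord (hγ : MDifferentiableAt 𝓘(ℝ, ℝ) I γ t)
    (V : Π t : ℝ, TangentSpace I (γ t)) :
    (fun s => (trivializationAt E (TangentSpace I : M → Type _) (γ t)
        (⟨γ s, V s⟩ : TangentBundle I M)).2) =ᶠ[nhds t] fun s => toCoord I (γ t) (γ s) (V s) := by
  filter_upwards [eventually_mem_source hγ] with s hs using snd_trivializationAt_eq_toCoord hs _

lemma diffAlongAt_iff (hγ : MDifferentiableAt 𝓘(ℝ, ℝ) I γ t) :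
    DiffAlongAt I γ V t ↔ DifferentiableAt ℝ (fun s => toCoord I (γ t) (γ s) (V s)) t := by
  rw [DiffAlongAt, mdifferentiableAt_totalSpace, ← mdifferentiableAt_iff_differentiableAt]
  rw [← (snd_eventuallyEq_toCoord hγ V).mdifferentiableAt_iff]
  exact and_iff_right hγ

lemma DiffAlongAt.differentiableAt (h : DiffAlongAt I γ V t) :
    DifferentiableAt ℝ (fun s => toCoord I (γ t) (γ s) (V s)) t := (diffAlongAt_iff h.base).1 h

lemma DiffAlongAt.congr (h : DiffAlongAt I γ V t) (hVW : ∀ᶠ s in nhds t, W s = V s) :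
    DiffAlongAt I γ W t := by
  refine MDifferentiableAt.congr_of_eventuallyEq h ?_
  filter_upwards [hVW] with s hs
  rw [hs]

lemma DiffAlongAt.add (hV : DiffAlongAt I γ V t) (hW : DiffAlongAt I γ W t) :
    DiffAlongAt I γ (fun s => V s + W s) t := by
  rw [diffAlongAt_iff hV.base]
  simpa only [map_add] using hV.differentiableAt.fun_add hW.differentiableAt

lemma DiffAlongAt.smul {f : ℝ → ℝ} (hf : DifferentiableAt ℝ f t) (hV : DiffAlongAt I γ V t) :
    DiffAlongAt I γ (fun s => f s • V s) t := by
  rw [diffAlongAt_iff hV.base]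
  simpa only [map_smul] using hf.fun_smul hV.differentiableAt

lemma diffAlongAt_zero (hγ : MDifferentiableAt 𝓘(ℝ, ℝ) I γ t) :
    DiffAlongAt I γ (fun s => (0 : TangentSpace I (γ s))) t := by
  rw [diffAlongAt_iff hγ]
  simp

lemma hasDerivAt_extChartAt_comp (hγ : MDifferentiableAt 𝓘(ℝ, ℝ) I γ t) :
    HasDerivAt (fun s => extChartAt I (γ t) (γ s)) (toCoord I (γ t) (γ t) (velocity I γ t)) t := by
  have h1 := (mdifferentiableAt_extChartAt (I := I) (x := γ t) (y := γ t)
    (by simp)).hasMFDerivAt.comp t hγ.hasMFDerivAt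
  have h2 : DifferentiableAt ℝ (fun s => extChartAt I (γ t) (γ s)) t :=
    h1.mdifferentiableAt.differentiableAt
  refine h2.hasDerivAt.congr_deriv ?_
  rw [toCoord_eq_mfderiv (mem_extChartAt_source _), ← fderiv_apply_one_eq_deriv,
    ← mfderiv_eq_fderiv]
  exact congrArg (fun L => L (1 : ℝ)) h1.mfderiv

variable [RiemannianBundle (fun x : M => TangentSpace I x)]
variable [I.Boundaryless] [FiniteDimensional ℝ E]
  [IsContMDiffRiemannianBundle I ∞ E (fun x : M => TangentSpace I x)]

lemma toCoord_covDerivAlong (hγ : MDifferentiableAt 𝓘(ℝ, ℝ) I γ t) :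
    toCoord I (γ t) (γ t) (covDerivAlong I γ V t) =
      deriv (fun s => toCoord I (γ t) (γ s) (V s)) t +
        chr (coordMetric I (γ t)) (extChartAt I (γ t) (γ t))
          (toCoord I (γ t) (γ t) (velocity I γ t)) (toCoord I (γ t) (γ t) (V t)) := by
  have hp := mem_extChartAt_source (I := I) (γ t)
  have hz := mem_extChartAt_target (I := I) (γ t)
  have h1 : ∀ a : E, (trivializationAt E (TangentSpace I : M → Type _) (γ t)).symm (γ t) a
      = ofCoord I (γ t) (γ t) a := fun a =>
    (Bundle.Trivialization.symmL_apply _ (mem_baseSet_of_mem_source hp) a).symm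
  rw [covDerivAlong, map_add, h1, toCoord_ofCoord hp, (snd_eventuallyEq_toCoord hγ V).deriv_eq,
    toCoord_leviCivita hp (mdifferentiableAt_extend hp _), fderiv_coordField_extend hz,
    FiberBundle.extend_apply_self, zero_apply, zero_add]

/-- Locality is needed because the Frenet equations hold only on the open interval `J`, while fields
along the curve are indexed by all of `ℝ`. -/
lemma covDerivAlong_congr (hγ : MDifferentiableAt 𝓘(ℝ, ℝ) I γ t)
    (hVW : ∀ᶠ s in nhds t, V s = W s) : covDerivAlong I γ V t = covDerivAlong I γ W t := by
  refine toCoord_injective (mem_extChartAt_source (I := I) (γ t)) ?_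
  have h : (fun s => toCoord I (γ t) (γ s) (V s)) =ᶠ[nhds t]
      fun s => toCoord I (γ t) (γ s) (W s) := by
    filter_upwards [hVW] with s hs
    rw [hs]
  rw [toCoord_covDerivAlong hγ, toCoord_covDerivAlong hγ, h.deriv_eq, hVW.self_of_nhds]

lemma covDerivAlong_add (hV : DiffAlongAt I γ V t) (hW : DiffAlongAt I γ W t) :
    covDerivAlong I γ (fun s => V s + W s) t = covDerivAlong I γ V t + covDerivAlong I γ W t := by
  refine toCoord_injective (mem_extChartAt_source (I := I) (γ t)) ?_
  rw [map_add, toCoord_covDerivAlong hV.base, toCoord_covDerivAlong hV.base,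
    toCoord_covDerivAlong hV.base]
  simp only [map_add]
  rw [deriv_fun_add hV.differentiableAt hW.differentiableAt]
  abel

lemma covDerivAlong_smul {f : ℝ → ℝ} (hf : DifferentiableAt ℝ f t) (hV : DiffAlongAt I γ V t) :
    covDerivAlong I γ (fun s => f s • V s) t = deriv f t • V t + f t • covDerivAlong I γ V t := by
  refine toCoord_injective (mem_extChartAt_source (I := I) (γ t)) ?_
  rw [map_add, map_smul, map_smul, toCoord_covDerivAlong hV.base, toCoord_covDerivAlong hV.base]
  simp only [map_smul]
  rw [deriv_fun_smul hf hV.differentiableAt, smul_add]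
  abel

lemma hasDerivAt_inner (hV : DiffAlongAt I γ V t) (hW : DiffAlongAt I γ W t) :
    HasDerivAt (fun s => (inner ℝ (V s) (W s) : ℝ))
      (inner ℝ (covDerivAlong I γ V t) (W t) + inner ℝ (V t) (covDerivAlong I γ W t)) t := by
  have hp := mem_extChartAt_source (I := I) (γ t)
  have hz := mem_extChartAt_target (I := I) (γ t)
  have hg := isLocalMetric_coordMetric (I := I) (γ t)
  have h1 := (hg.differentiableAt hz).hasFDerivAt.comp_hasDerivAt t
    (hasDerivAt_extChartAt_comp hV.base)
  have h2 := (h1.clm_apply hV.differentiableAt.hasDerivAt).clm_apply hW.differentiableAt.hasDerivAt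
  have h3 : (fun s => (inner ℝ (V s) (W s) : ℝ)) =ᶠ[nhds t] fun s =>
      coordMetric I (γ t) (extChartAt I (γ t) (γ s)) (toCoord I (γ t) (γ s) (V s))
        (toCoord I (γ t) (γ s) (W s)) := by
    filter_upwards [eventually_mem_source hV.base] with s hs using (coordMetric_toCoord hs _ _).symm
  refine (h2.congr_of_eventuallyEq h3).congr_deriv ?_
  rw [← coordMetric_toCoord hp, ← coordMetric_toCoord hp, toCoord_covDerivAlong hV.base,
    toCoord_covDerivAlong hV.base]
  simp only [map_add, add_apply, hg.fderiv_eq hz, Function.comp_apply]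
  ring

end Curves

/-! ### Sasakian structures in a chart -/

section SasakianCoordinates

variable {E : Type*} [NormedAddCommGroup E] [NormedSpace ℝ E]
  {H : Type*} [TopologicalSpace H] {I : ModelWithCorners ℝ E H}
  {M : Type*} [TopologicalSpace M] [ChartedSpace H M] [IsManifold I ∞ M]
  {p y : M}

/-- The contact and normality conditions are stated for globally smooth fields; a bump function
makes coordinate-constant fields admissible as test fields. -/
lemma exists_smoothField_eventuallyEq_ofCoord [FiniteDimensional ℝ E] [T2Space M]
    (hy : y ∈ (extChartAt I p).source)
    (a : E) : ∃ X : Π x : M, TangentSpace I x, SmoothField I X ∧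
      ∀ᶠ x in nhds y, X x = ofCoord I p x a := by
  obtain ⟨f, -, hf⟩ := (SmoothBumpFunction.nhds_basis_tsupport (I := I) y).mem_iff.1
    ((isOpen_extChartAt_source p).mem_nhds hy)
  refine ⟨(f : M → ℝ) • fun x => ofCoord I p x a, ?_, ?_⟩
  · exact ContMDiffOn.smul_section_of_tsupport f.contMDiff.contMDiffOn
      (isOpen_extChartAt_source p) hf
      fun x hx => (contMDiffAt_ofCoord hx a).contMDiffWithinAt
  · filter_upwards [f.eventuallyEq_one] with x hx
    rw [Pi.smul_apply', hx, Pi.one_apply, one_smul]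

variable [RiemannianBundle (fun x : M => TangentSpace I x)]

namespace ContactMetricStructure

variable (S : ContactMetricStructure I M)

/-- The tensor `φ` in the preferred chart at `p`. -/
noncomputable def coordφ (p : M) (z : E) : E →L[ℝ] E :=
  toCoord I p ((extChartAt I p).symm z) ∘L S.φ ((extChartAt I p).symm z) ∘L
    ofCoord I p ((extChartAt I p).symm z)

/-- The form `η` in the preferred chart at `p`. -/
noncomputable def coordη (p : M) (z : E) : E →L[ℝ] ℝ :=
  S.η ((extChartAt I p).symm z) ∘L ofCoord I p ((extChartAt I p).symm z)

lemma coordφ_toCoord (hy : y ∈ (extChartAt I p).source) (v : TangentSpace I y) :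
    S.coordφ p (extChartAt I p y) (toCoord I p y v) = toCoord I p y (S.φ y v) := by
  rw [coordφ, ContinuousLinearMap.comp_apply, ContinuousLinearMap.comp_apply,
    (extChartAt I p).left_inv hy, ofCoord_toCoord hy]

lemma coordη_toCoord (hy : y ∈ (extChartAt I p).source) (v : TangentSpace I y) :
    S.coordη p (extChartAt I p y) (toCoord I p y v) = S.η y v := by
  rw [coordη, ContinuousLinearMap.comp_apply, (extChartAt I p).left_inv hy, ofCoord_toCoord hy]

lemma contMDiffAt_φ {X : Π x : M, TangentSpace I x}
    (hX : ContMDiffAt I I.tangent ∞ (fun x => (⟨x, X x⟩ : TangentBundle I M)) y) :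
    ContMDiffAt I I.tangent ∞ (fun x => (⟨x, S.φ x (X x)⟩ : TangentBundle I M)) y :=
  ContMDiffAt.clm_bundle_apply (b := id) (F₁ := E) (F₂ := E) (IB := I)
    (E₁ := fun x : M => TangentSpace I x) (E₂ := fun x : M => TangentSpace I x)
    S.smooth_φ.contMDiffAt hX

lemma contMDiffAt_η {X : Π x : M, TangentSpace I x}
    (hX : ContMDiffAt I I.tangent ∞ (fun x => (⟨x, X x⟩ : TangentBundle I M)) y) :
    ContMDiffAt I 𝓘(ℝ, ℝ) ∞ (fun x => S.η x (X x)) y := by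
  have := ContMDiffAt.clm_bundle_apply (b := id) (F₁ := E) (F₂ := ℝ) (IB := I)
    (E₁ := fun x : M => TangentSpace I x) (E₂ := Bundle.Trivial M ℝ)
    S.smooth_η.contMDiffAt hX
  exact ((Bundle.contMDiffAt_totalSpace).1 this).2

variable [I.Boundaryless]

lemma contDiffOn_coordφ [FiniteDimensional ℝ E] (p : M) :
    ContDiffOn ℝ ∞ (S.coordφ p) (extChartAt I p).target := by
  refine contDiffOn_clm_apply.2 fun a z hz => ?_
  have hs := (extChartAt I p).map_target hz
  have h := contDiffAt_coordField hs (S.contMDiffAt_φ (contMDiffAt_ofCoord hs a))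
  rw [(extChartAt I p).right_inv hz] at h
  exact h.contDiffWithinAt

lemma contDiffOn_coordη [FiniteDimensional ℝ E] (p : M) :
    ContDiffOn ℝ ∞ (S.coordη p) (extChartAt I p).target := by
  refine contDiffOn_clm_apply.2 fun a z hz => ?_
  have hs := (extChartAt I p).map_target hz
  exact (contMDiffAt_iff_contDiffAt.1 ((S.contMDiffAt_η (contMDiffAt_ofCoord hs a)).comp z
    (contMDiffAt_extChartAt_symm hz))).contDiffWithinAt

lemma contDiffOn_coordField_ξ (p : M) :
    ContDiffOn ℝ ∞ (coordField I p S.ξ) (extChartAt I p).target := by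
  intro z hz
  have h := contDiffAt_coordField ((extChartAt I p).map_target hz) (S.smooth_ξ _)
  rw [(extChartAt I p).right_inv hz] at h
  exact h.contDiffWithinAt

variable {S} [FiniteDimensional ℝ E]

lemma fderiv_coordφ_apply {z : E} (hz : z ∈ (extChartAt I p).target) {X : Π x : M, TangentSpace I x}
    {a : E} (hX : ∀ᶠ x in nhds ((extChartAt I p).symm z), X x = ofCoord I p x a) :
    fderiv ℝ (coordField I p fun x => S.φ x (X x)) z = (fderiv ℝ (S.coordφ p) z).flip a := by
  have h1 : coordField I p (fun x => S.φ x (X x)) =ᶠ[nhds z] fun z => S.coordφ p z a := by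
    filter_upwards [(contMDiffAt_extChartAt_symm hz).continuousAt hX] with x hx
    rw [coordField, hx]
    rfl
  have h2 := (((S.contDiffOn_coordφ p).contDiffAt (mem_nhds_target hz)).differentiableAt
    (by simp)).hasFDerivAt.clm_apply (hasFDerivAt_const a z)
  rw [h1.fderiv_eq]
  erw [h2.fderiv]
  ext u
  simp only [add_apply, ContinuousLinearMap.comp_apply, ContinuousLinearMap.flip_apply,
    zero_apply, map_zero, zero_add]

lemma mvfderiv_η {z : E} (hz : z ∈ (extChartAt I p).target) {X : Π x : M, TangentSpace I x}
    {a : E} (hX : ∀ᶠ x in nhds ((extChartAt I p).symm z), X x = ofCoord I p x a) (b : E) :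
    mvfderiv I (fun x => S.η x (X x)) ((extChartAt I p).symm z)
      (ofCoord I p ((extChartAt I p).symm z) b) = fderiv ℝ (S.coordη p) z b a := by
  have hs := (extChartAt I p).map_target hz
  have h0 : ContMDiffAt I I.tangent ∞ (fun x => (⟨x, X x⟩ : TangentBundle I M))
      ((extChartAt I p).symm z) := by
    refine (contMDiffAt_ofCoord hs a).congr_of_eventuallyEq ?_
    filter_upwards [hX] with x hx
    rw [hx]
  have h1 : (fun x => S.η x (X x)) ∘ (extChartAt I p).symm =ᶠ[nhds z]
      fun z => S.coordη p z a := by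
    filter_upwards [(contMDiffAt_extChartAt_symm hz).continuousAt hX] with x hx
    rw [Function.comp_apply, hx]
    rfl
  have h2 := (((S.contDiffOn_coordη p).contDiffAt (mem_nhds_target hz)).differentiableAt
    (by simp)).hasFDerivAt.clm_apply (hasFDerivAt_const a z)
  rw [mvfderiv_eq_fderiv hs ((S.contMDiffAt_η h0).mdifferentiableAt (by simp)),
    toCoord_ofCoord hs, (extChartAt I p).right_inv hz, h1.fderiv_eq]
  erw [h2.fderiv]
  simp only [add_apply, ContinuousLinearMap.comp_apply, ContinuousLinearMap.flip_apply,
    zero_apply, map_zero, zero_add]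

variable [T2Space M] [IsContMDiffRiemannianBundle I ∞ E (fun x : M => TangentSpace I x)]

lemma IsSasakian.isLocalSasakian (hS : S.IsSasakian) (p : M) :
    IsLocalSasakian (coordMetric I p) (S.coordφ p) (coordField I p S.ξ) (S.coordη p)
      (extChartAt I p).target := by
  -- Test on fields equal to the constants `a`, `b` near the point: their bracket vanishes,
  -- $[\varphi a,\varphi b]=D\varphi(\varphi a)b-D\varphi(\varphi b)a$ and $[\varphi
  -- a,b]=-D\varphi(b)a$.
  have key : ∀ z ∈ (extChartAt I p).target, ∀ a b,
      coordMetric I p z a (S.coordφ p z b) =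
        (1 / 2 : ℝ) * (fderiv ℝ (S.coordη p) z a b - fderiv ℝ (S.coordη p) z b a) ∧
      fderiv ℝ (S.coordφ p) z (S.coordφ p z a) b - fderiv ℝ (S.coordφ p) z (S.coordφ p z b) a
        + S.coordφ p z (fderiv ℝ (S.coordφ p) z b a) - S.coordφ p z (fderiv ℝ (S.coordφ p) z a b)
        + (2 * coordMetric I p z a (S.coordφ p z b)) • coordField I p S.ξ z = 0 := by
    intro z hz a b
    have hs := (extChartAt I p).map_target hz
    obtain ⟨X, hX, hXa⟩ := exists_smoothField_eventuallyEq_ofCoord hs a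
    obtain ⟨Y, hY, hYb⟩ := exists_smoothField_eventuallyEq_ofCoord hs b
    have hφX := (S.contMDiffAt_φ (hX ((extChartAt I p).symm z))).mdifferentiableAt (by simp)
    have hφY := (S.contMDiffAt_φ (hY ((extChartAt I p).symm z))).mdifferentiableAt (by simp)
    have hX' := (hX ((extChartAt I p).symm z)).mdifferentiableAt (by simp)
    have hY' := (hY ((extChartAt I p).symm z)).mdifferentiableAt (by simp)
    have hconst : ∀ {X : Π x : M, TangentSpace I x} {a : E},
        (∀ᶠ x in nhds ((extChartAt I p).symm z), X x = ofCoord I p x a) →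
        fderiv ℝ (coordField I p X) z = 0 := by
      intro X a hXa
      have h1 : coordField I p X =ᶠ[nhds z] fun _ => a := by
        filter_upwards [(contMDiffAt_extChartAt_symm hz).continuousAt hXa, mem_nhds_target hz]
          with x hx hxt
        rw [coordField, hx, toCoord_ofCoord ((extChartAt I p).map_target hxt)]
      rw [h1.fderiv_eq, fderiv_fun_const, Pi.zero_apply]
    have hXz := hXa.self_of_nhds
    have hYz := hYb.self_of_nhds
    have hbr : VectorField.mlieBracket I X Y ((extChartAt I p).symm z) = 0 := by
      refine toCoord_injective hs ?_
      rw [toCoord_mlieBracket hs hX' hY', (extChartAt I p).right_inv hz, hconst hXa, hconst hYb]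
      simp only [zero_apply, sub_zero, map_zero]
    have h1 := S.inner_φ X Y hX hY ((extChartAt I p).symm z)
    have h2 := congrArg (toCoord I p _) (hS X Y hX hY ((extChartAt I p).symm z))
    rw [← h1, nijenhuis, hbr] at h2
    rw [extDerivOneForm, hbr, hXz, hYz, mvfderiv_η hz hXa, mvfderiv_η hz hYb, map_zero,
      sub_zero] at h1
    have hg : coordMetric I p z a (S.coordφ p z b) = inner ℝ (ofCoord I p _ a)
        (S.φ _ (ofCoord I p ((extChartAt I p).symm z) b)) := by
      rw [coordMetric_apply, coordφ, ContinuousLinearMap.comp_apply,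
        ContinuousLinearMap.comp_apply, ofCoord_toCoord hs]
    refine ⟨hg.trans h1, ?_⟩
    simp only [map_add, map_sub, map_smul, map_zero, add_zero] at h2
    rw [← coordφ_toCoord S hs, ← coordφ_toCoord S hs, toCoord_mlieBracket hs hφX hφY,
      toCoord_mlieBracket hs hφX hY', toCoord_mlieBracket hs hX' hφY,
      (extChartAt I p).right_inv hz, fderiv_coordφ_apply hz hXa, fderiv_coordφ_apply hz hYb,
      hconst hXa, hconst hYb, hXz, hYz] at h2
    simp only [zero_apply, zero_sub, sub_zero, map_neg, ContinuousLinearMap.flip_apply,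
      toCoord_ofCoord hs] at h2
    rw [← h2, hg]
    simp only [sub_neg_eq_add]
    rfl
  have hφs : ∀ z ∈ (extChartAt I p).target, ∀ a, S.coordφ p z a =
      toCoord I p _ (S.φ _ (ofCoord I p ((extChartAt I p).symm z) a)) := fun _ _ _ => rfl
  refine { toIsLocalMetric := isLocalMetric_coordMetric p
           contDiffOn_φ := S.contDiffOn_coordφ p
           contDiffOn_ξ := S.contDiffOn_coordField_ξ p
           contDiffOn_η := S.contDiffOn_coordη p
           φ_φ := ?_
           η_ξ := ?_
           g_φ_φ := ?_
           g_φ := fun z hz a b => (key z hz a b).1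
           normal := fun z hz a b => (key z hz a b).2 }
  · intro z hz a
    have hs := (extChartAt I p).map_target hz
    rw [hφs z hz, hφs z hz, ofCoord_toCoord hs, S.φ_φ, map_add, map_neg, map_smul,
      toCoord_ofCoord hs]
    rfl
  · intro z hz
    have hs := (extChartAt I p).map_target hz
    rw [coordη, coordField, ContinuousLinearMap.comp_apply, ofCoord_toCoord hs, S.η_ξ]
  · intro z hz a b
    have hs := (extChartAt I p).map_target hz
    rw [coordMetric_apply, coordMetric_apply, hφs z hz, hφs z hz, ofCoord_toCoord hs,
      ofCoord_toCoord hs, S.inner_φ_φ]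
    rfl

end ContactMetricStructure
end SasakianCoordinates

/-! ### Sasakian identities on the manifold and along curves -/

section SasakianCurves

variable {E : Type*} [NormedAddCommGroup E] [NormedSpace ℝ E] [FiniteDimensional ℝ E]
  {H : Type*} [TopologicalSpace H] {I : ModelWithCorners ℝ E H} [I.Boundaryless]
  {M : Type*} [TopologicalSpace M] [T2Space M] [ChartedSpace H M] [IsManifold I ∞ M]
  [RiemannianBundle (fun x : M => TangentSpace I x)]
  [IsContMDiffRiemannianBundle I ∞ E (fun x : M => TangentSpace I x)]
  {S : ContactMetricStructure I M}

namespace ContactMetricStructure.IsSasakian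

lemma inner_ξ (hS : S.IsSasakian) (p : M) (v : TangentSpace I p) :
    inner ℝ v (S.ξ p) = S.η p v := by
  have hp := mem_extChartAt_source (I := I) p
  have h := (hS.isLocalSasakian p).g_ξ (mem_extChartAt_target p) (toCoord I p p v)
  rwa [coordField_extChartAt hp, coordMetric_toCoord hp, coordη_toCoord S hp] at h

lemma φ_skew (hS : S.IsSasakian) (p : M) (u v : TangentSpace I p) :
    (inner ℝ (S.φ p u) v : ℝ) = -inner ℝ u (S.φ p v) := by
  have hp := mem_extChartAt_source (I := I) p
  have h := (hS.isLocalSasakian p).g_φ_skew (mem_extChartAt_target p) (toCoord I p p u)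
    (toCoord I p p v)
  rw [coordφ_toCoord S hp, coordφ_toCoord S hp, coordMetric_toCoord hp,
    coordMetric_toCoord hp] at h
  rw [h, neg_neg]

lemma η_φ (hS : S.IsSasakian) (p : M) (v : TangentSpace I p) : S.η p (S.φ p v) = 0 := by
  have hp := mem_extChartAt_source (I := I) p
  have h := (hS.isLocalSasakian p).η_φ (mem_extChartAt_target p) (toCoord I p p v)
  rwa [coordφ_toCoord S hp, coordη_toCoord S hp] at h

lemma hasDerivAt_toCoord_φ (hS : S.IsSasakian) {γ : ℝ → M} {t : ℝ}
    {V : Π t : ℝ, TangentSpace I (γ t)} (hV : DiffAlongAt I γ V t) :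
    HasDerivAt (fun s => toCoord I (γ t) (γ s) (S.φ (γ s) (V s)))
      (fderiv ℝ (S.coordφ (γ t)) (extChartAt I (γ t) (γ t))
        (toCoord I (γ t) (γ t) (velocity I γ t)) (toCoord I (γ t) (γ t) (V t)) +
      S.coordφ (γ t) (extChartAt I (γ t) (γ t))
        (deriv (fun s => toCoord I (γ t) (γ s) (V s)) t)) t := by
  have h1 := ((hS.isLocalSasakian (γ t)).hasFDerivAt_φ
    (mem_extChartAt_target (I := I) (γ t))).comp_hasDerivAt t
    (hasDerivAt_extChartAt_comp hV.base)
  refine (h1.clm_apply hV.differentiableAt.hasDerivAt).congr_of_eventuallyEq ?_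
  filter_upwards [eventually_mem_source hV.base] with s hs using (coordφ_toCoord S hs _).symm

lemma diffAlongAt_φ (hS : S.IsSasakian) {γ : ℝ → M} {t : ℝ} {V : Π t : ℝ, TangentSpace I (γ t)}
    (hV : DiffAlongAt I γ V t) : DiffAlongAt I γ (fun s => S.φ (γ s) (V s)) t :=
  (diffAlongAt_iff hV.base).2 (hS.hasDerivAt_toCoord_φ hV).differentiableAt

lemma covDerivAlong_φ (hS : S.IsSasakian) {γ : ℝ → M} {t : ℝ} {V : Π t : ℝ, TangentSpace I (γ t)}
    (hV : DiffAlongAt I γ V t) : covDerivAlong I γ (fun s => S.φ (γ s) (V s)) t =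
        (inner ℝ (velocity I γ t) (V t) : ℝ) • S.ξ (γ t) - S.η (γ t) (V t) • velocity I γ t
          + S.φ (γ t) (covDerivAlong I γ V t) := by
  have hp := mem_extChartAt_source (I := I) (γ t)
  refine toCoord_injective hp ?_
  rw [toCoord_covDerivAlong hV.base, (hS.hasDerivAt_toCoord_φ hV).deriv,
    (hS.isLocalSasakian (γ t)).fderiv_φ_apply (mem_extChartAt_target (γ t)),
    coordMetric_toCoord hp, coordη_toCoord S hp, coordField_extChartAt hp, map_add, map_sub,
    map_smul, map_smul, ← coordφ_toCoord S hp, ← coordφ_toCoord S hp,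
    toCoord_covDerivAlong hV.base, map_add]
  abel

lemma diffAlongAt_ξ (hS : S.IsSasakian) {γ : ℝ → M} {t : ℝ}
    (hγ : MDifferentiableAt 𝓘(ℝ, ℝ) I γ t) : DiffAlongAt I γ (fun s => S.ξ (γ s)) t ∧
      covDerivAlong I γ (fun s => S.ξ (γ s)) t = -S.φ (γ t) (velocity I γ t) := by
  have hp := mem_extChartAt_source (I := I) (γ t)
  have hz := mem_extChartAt_target (I := I) (γ t)
  have hl := hS.isLocalSasakian (γ t)
  have h1 := (hl.hasFDerivAt_ξ hz).comp_hasDerivAt t (hasDerivAt_extChartAt_comp hγ)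
  have h2 : (fun s => toCoord I (γ t) (γ s) (S.ξ (γ s))) =ᶠ[nhds t]
      fun s => coordField I (γ t) S.ξ (extChartAt I (γ t) (γ s)) := by
    filter_upwards [eventually_mem_source hγ] with s hs using (coordField_extChartAt hs _).symm
  have h3 := h1.congr_of_eventuallyEq h2
  refine ⟨(diffAlongAt_iff hγ).2 h3.differentiableAt, ?_⟩
  refine toCoord_injective hp ?_
  rw [toCoord_covDerivAlong hγ, h3.deriv, hl.fderiv_ξ_apply hz, map_neg, ← coordφ_toCoord S hp,
    ← coordField_extChartAt hp]
  abel

end ContactMetricStructure.IsSasakian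

lemma ContactMetricStructure.IsSasakianSpaceForm.curvature_eq {c : ℝ}
    (hS : S.IsSasakianSpaceForm c) {p : M} {T u : TangentSpace I p}
    (hT : inner ℝ T T = (1 : ℝ)) (hηT : S.η p T = 0) (hηu : S.η p u = 0)
    (huT : inner ℝ u T = (0 : ℝ)) (huφT : inner ℝ u (S.φ p T) = (0 : ℝ)) :
    curvature I p T u T = -((c + 3) / 4) • u := by
  have hp := mem_extChartAt_source (I := I) p
  have hz := mem_extChartAt_target (I := I) p
  have hl := hS.1.isLocalSasakian p
  refine curvature_eq_of_sasakianSpaceForm (R := curvature I p) (S.φ_φ p) (hS.1.η_φ p)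
    (hS.1.φ_skew p) (hS.1.inner_ξ p) (S.η_ξ p) ?_ ?_ ?_ ?_ ?_ ?_ ?_ (hS.2 p) hT hηT hηu huT huφT
  · intro x x' y z
    refine toCoord_injective hp ?_
    simp only [map_add, toCoord_curvature, riem, add_apply]
    abel
  · intro a x y z
    refine toCoord_injective hp ?_
    simp only [map_smul, toCoord_curvature, riem, smul_apply]
    module
  · intro x y z
    refine toCoord_injective hp ?_
    rw [map_neg, toCoord_curvature, toCoord_curvature, IsLocalMetric.riem_skew]
  · intro x y z w
    rw [← coordMetric_toCoord hp, ← coordMetric_toCoord hp, toCoord_curvature, toCoord_curvature,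
      hl.riem_skew_right hz, hl.symm _ hz]
  · intro x y z
    refine toCoord_injective hp ?_
    simp only [map_add, map_zero, toCoord_curvature, hl.riem_bianchi hz]
  · intro x y
    refine toCoord_injective hp ?_
    rw [toCoord_curvature, ← coordField_extChartAt hp, hl.riem_ξ hz, map_sub, map_smul, map_smul,
      coordη_toCoord S hp, coordη_toCoord S hp]
  · intro x y z
    refine toCoord_injective hp ?_
    rw [toCoord_curvature, ← coordφ_toCoord S hp, hl.riem_φ hz]
    simp only [map_add, map_sub, map_smul, coordφ_toCoord S hp, coordMetric_toCoord hp,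
      ← toCoord_curvature]

end SasakianCurves

/-! ### The Frenet equations and the third derivative of a curve -/

section Frenet

variable {E : Type*} [NormedAddCommGroup E] [NormedSpace ℝ E]
  {H : Type*} [TopologicalSpace H] {I : ModelWithCorners ℝ E H}
  {M : Type*} [TopologicalSpace M] [ChartedSpace H M]
  {γ : ℝ → M} {J : Set ℝ} {r : ℕ} {e : ℕ → Π t : ℝ, TangentSpace I (γ t)} {κ : ℕ → ℝ → ℝ} {t : ℝ}

/-- The Frenet frame `e₁, …, e_r`, extended by zero to indices greater than `r`. -/
noncomputable def extFrame (r : ℕ) (e : ℕ → Π t : ℝ, TangentSpace I (γ t)) (i : ℕ) (t : ℝ) :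
    TangentSpace I (γ t) := if i ≤ r then e i t else 0

/-- The curvatures `κ₁, …, κ_{r-1}`, extended by zero to the other indices. -/
noncomputable def extCurv (r : ℕ) (κ : ℕ → ℝ → ℝ) (i : ℕ) (t : ℝ) : ℝ :=
  if 1 ≤ i ∧ i < r then κ i t else 0

lemma extFrame_of_le {i : ℕ} (hi : i ≤ r) : extFrame r e i = e i := by
  funext t
  rw [extFrame, if_pos hi]

lemma extFrame_of_lt {i : ℕ} (hi : r < i) : extFrame r e i = 0 := by
  funext t
  rw [extFrame, if_neg (by omega), Pi.zero_apply]

lemma extCurv_of_lt {i : ℕ} (h1 : 1 ≤ i) (hi : i < r) : extCurv r κ i = κ i := by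
  funext t
  rw [extCurv, if_pos ⟨h1, hi⟩]

lemma extCurv_of_le {i : ℕ} (hi : r ≤ i) : extCurv r κ i = 0 := by
  funext t
  rw [extCurv, if_neg (by omega), Pi.zero_apply]

lemma extCurv_zero : extCurv r κ 0 = 0 := by
  funext t
  rw [extCurv, if_neg (by omega), Pi.zero_apply]

variable [IsManifold I ∞ M] [RiemannianBundle (fun x : M => TangentSpace I x)]
  [FiniteDimensional ℝ E]

namespace IsFrenetCurve

lemma mdifferentiableAt (hγ : IsFrenetCurve I γ J r e κ) (hJ : IsOpen J) (ht : t ∈ J) :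
    MDifferentiableAt 𝓘(ℝ, ℝ) I γ t :=
  (hγ.smooth.contMDiffAt (hJ.mem_nhds ht)).mdifferentiableAt (by simp)

lemma diffAlongAt (hγ : IsFrenetCurve I γ J r e κ) (hJ : IsOpen J) (ht : t ∈ J) {i : ℕ}
    (hi : 1 ≤ i) : DiffAlongAt I γ (extFrame r e i) t := by
  rcases le_or_gt i r with h | h
  · rw [extFrame_of_le h]
    exact ((hγ.smooth_frame i hi h).contMDiffAt (hJ.mem_nhds ht)).mdifferentiableAt (by simp)
  · rw [extFrame_of_lt h]
    exact diffAlongAt_zero (hγ.mdifferentiableAt hJ ht)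

lemma contDiffOn_extCurv (hγ : IsFrenetCurve I γ J r e κ) (i : ℕ) :
    ContDiffOn ℝ ∞ (extCurv r κ i) J := by
  by_cases h : 1 ≤ i ∧ i < r
  · rw [extCurv_of_lt h.1 h.2]
    exact hγ.smooth_curvature i h.1 h.2
  · have : extCurv r κ i = fun _ => 0 := by
      funext t
      rw [extCurv, if_neg h]
    rw [this]
    exact contDiffOn_const

lemma inner_extFrame (hγ : IsFrenetCurve I γ J r e κ) (ht : t ∈ J) {i j : ℕ} (hi : 1 ≤ i)
    (hj : 1 ≤ j) : (inner ℝ (extFrame r e i t) (extFrame r e j t) : ℝ) =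
      if i = j ∧ i ≤ r then 1 else 0 := by
  rcases le_or_gt i r with h | h
  · rcases le_or_gt j r with h' | h'
    · rw [extFrame_of_le h, extFrame_of_le h', hγ.orthonormal t ht i j hi h hj h']
      simp only [h, and_true]
    · rw [extFrame_of_lt h', Pi.zero_apply, inner_zero_right, if_neg (by omega)]
  · rw [extFrame_of_lt h, Pi.zero_apply, inner_zero_left, if_neg (by omega)]

lemma extFrame_one (hγ : IsFrenetCurve I γ J r e κ) (ht : t ∈ J) :
    extFrame r e 1 t = velocity I γ t := by
  rw [extFrame_of_le hγ.one_le, hγ.first t ht]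

lemma inner_velocity (hγ : IsFrenetCurve I γ J r e κ) (ht : t ∈ J) :
    inner ℝ (velocity I γ t) (velocity I γ t) = (1 : ℝ) := by
  rw [← hγ.extFrame_one ht, hγ.inner_extFrame ht le_rfl le_rfl, if_pos ⟨rfl, hγ.one_le⟩]

variable [I.Boundaryless] [IsContMDiffRiemannianBundle I ∞ E (fun x : M => TangentSpace I x)]

/-- The extension by zero puts all osculating orders into one formula. For `i = 1` the arbitrary
vector `e 0` appears, but with coefficient `extCurv r κ 0`, which is zero. -/
lemma covDerivAlong_extFrame (hγ : IsFrenetCurve I γ J r e κ) (hJ : IsOpen J) (ht : t ∈ J)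
    {i : ℕ} (hi : 1 ≤ i) : covDerivAlong I γ (extFrame r e i) t =
      -(extCurv r κ (i - 1) t • extFrame r e (i - 1) t)
        + extCurv r κ i t • extFrame r e (i + 1) t := by
  rcases le_or_gt i r with h | h
  · rw [extFrame_of_le h, hγ.frenet t ht i hi h]
    congr 1
    · split_ifs with h1
      · rw [extCurv_of_lt (by omega) (by omega), extFrame_of_le (by omega)]
      · rw [show i - 1 = 0 by omega, extCurv_zero, Pi.zero_apply, zero_smul, neg_zero]
    · split_ifs with h1
      · rw [extCurv_of_lt hi h1, extFrame_of_le (by omega)]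
      · rw [extCurv_of_le (by omega), Pi.zero_apply, zero_smul]
  -- Beyond index `r` the frame field is zero; its derivative vanishes by the Leibniz rule with
  -- factor zero.
  · have h0 := covDerivAlong_smul (f := fun _ => (0 : ℝ)) (by fun_prop)
      (hγ.diffAlongAt hJ ht hi)
    rw [extFrame_of_lt h, extCurv_of_le (show r ≤ i - 1 by omega), extCurv_of_le h.le]
    simp only [zero_smul, deriv_const, add_zero] at h0
    simp only [Pi.zero_apply, zero_smul, neg_zero, add_zero]
    exact h0

lemma tension_eq (hγ : IsFrenetCurve I γ J r e κ) (hJ : IsOpen J) (ht : t ∈ J) :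
    tension I γ t = extCurv r κ 1 t • extFrame r e 2 t := by
  have h : ∀ᶠ s in nhds t, velocity I γ s = extFrame r e 1 s := by
    filter_upwards [hJ.mem_nhds ht] with s hs using (hγ.extFrame_one hs).symm
  rw [tension, covDerivAlong_congr (hγ.mdifferentiableAt hJ ht) h,
    hγ.covDerivAlong_extFrame hJ ht le_rfl, Nat.sub_self, extCurv_zero, Pi.zero_apply, zero_smul,
    neg_zero, zero_add]

lemma covDerivAlong_smul_extFrame (hγ : IsFrenetCurve I γ J r e κ) (hJ : IsOpen J) (ht : t ∈ J)
    {f : ℝ → ℝ} (hf : DifferentiableAt ℝ f t) {i : ℕ} (hi : 1 ≤ i) :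
    DiffAlongAt I γ (fun s => f s • extFrame r e i s) t ∧
    covDerivAlong I γ (fun s => f s • extFrame r e i s) t =
      deriv f t • extFrame r e i t
      + f t • (-(extCurv r κ (i - 1) t • extFrame r e (i - 1) t)
        + extCurv r κ i t • extFrame r e (i + 1) t) :=
  ⟨(hγ.diffAlongAt hJ ht hi).smul hf, by
    rw [covDerivAlong_smul hf (hγ.diffAlongAt hJ ht hi), hγ.covDerivAlong_extFrame hJ ht hi]⟩

lemma covDerivAlong_tension (hγ : IsFrenetCurve I γ J r e κ) (hJ : IsOpen J) (ht : t ∈ J) :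
    covDerivAlong I γ (tension I γ) t =
      -(extCurv r κ 1 t ^ 2) • extFrame r e 1 t
        + (deriv (extCurv r κ 1) t • extFrame r e 2 t
        + (extCurv r κ 1 t * extCurv r κ 2 t) • extFrame r e 3 t) := by
  have h : ∀ᶠ s in nhds t, tension I γ s = extCurv r κ 1 s • extFrame r e 2 s := by
    filter_upwards [hJ.mem_nhds ht] with s hs using hγ.tension_eq hJ hs
  have hd := ((hγ.contDiffOn_extCurv 1).contDiffAt (hJ.mem_nhds ht)).differentiableAt (by simp)
  rw [covDerivAlong_congr (hγ.mdifferentiableAt hJ ht) h,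
    (hγ.covDerivAlong_smul_extFrame hJ ht hd one_le_two).2]
  module

lemma covDerivAlong_covDerivAlong_tension (hγ : IsFrenetCurve I γ J r e κ) (hJ : IsOpen J)
    (ht : t ∈ J) :
    covDerivAlong I γ (covDerivAlong I γ (tension I γ)) t =
      (-(3 * extCurv r κ 1 t * deriv (extCurv r κ 1) t)) • extFrame r e 1 t
        + (deriv (deriv (extCurv r κ 1)) t
          - extCurv r κ 1 t * (extCurv r κ 1 t ^ 2 + extCurv r κ 2 t ^ 2)) • extFrame r e 2 t
        + (2 * deriv (extCurv r κ 1) t * extCurv r κ 2 t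
          + extCurv r κ 1 t * deriv (extCurv r κ 2) t) • extFrame r e 3 t
        + (extCurv r κ 1 t * extCurv r κ 2 t * extCurv r κ 3 t) • extFrame r e 4 t := by
  have h : ∀ᶠ s in nhds t, covDerivAlong I γ (tension I γ) s =
      -(extCurv r κ 1 s ^ 2) • extFrame r e 1 s
        + (deriv (extCurv r κ 1) s • extFrame r e 2 s
        + (extCurv r κ 1 s * extCurv r κ 2 s) • extFrame r e 3 s) := by
    filter_upwards [hJ.mem_nhds ht] with s hs using hγ.covDerivAlong_tension hJ hs
  have hd : ∀ i, DifferentiableAt ℝ (extCurv r κ i) t := fun i =>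
    ((hγ.contDiffOn_extCurv i).contDiffAt (hJ.mem_nhds ht)).differentiableAt (by simp)
  have hdd : DifferentiableAt ℝ (deriv (extCurv r κ 1)) t :=
    (((hγ.contDiffOn_extCurv 1).deriv_of_isOpen (m := ∞) hJ (by simp)).contDiffAt
      (hJ.mem_nhds ht)).differentiableAt (by simp)
  have h1 := hγ.covDerivAlong_smul_extFrame hJ ht ((hd 1).fun_pow 2).fun_neg le_rfl
  have h2 := hγ.covDerivAlong_smul_extFrame hJ ht hdd one_le_two
  have h3 := hγ.covDerivAlong_smul_extFrame hJ ht ((hd 1).fun_mul (hd 2)) (i := 3) (by omega)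
  rw [covDerivAlong_congr (hγ.mdifferentiableAt hJ ht) h,
    covDerivAlong_add h1.1 (h2.1.add h3.1), covDerivAlong_add h2.1 h3.1, h1.2, h2.2, h3.2,
    deriv_fun_mul (hd 1) (hd 2), deriv.fun_neg, deriv_fun_pow (hd 1), Nat.sub_self, extCurv_zero]
  simp only [Pi.zero_apply, zero_smul, Nat.add_one_sub_one, Nat.reduceAdd, Nat.reduceSub]
  module

lemma inner_tension_eq_zero (hγ : IsFrenetCurve I γ J r e κ) (hJ : IsOpen J) (ht : t ∈ J)
    {a : TangentSpace I (γ t)} (ha : 2 ≤ r → inner ℝ (e 2 t) a = (0 : ℝ)) :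
    inner ℝ (tension I γ t) a = (0 : ℝ) := by
  rw [hγ.tension_eq hJ ht]
  rcases le_or_gt 2 r with h | h
  · rw [extFrame_of_le h, inner_smul_left, ha h, mul_zero]
  · rw [extFrame_of_lt h, Pi.zero_apply, smul_zero, inner_zero_left]

lemma not_isHarmonic (hγ : IsFrenetCurve I γ J r e κ) (hJ : IsOpen J) (hJ₀ : J.Nonempty)
    (hr : 2 ≤ r) : ¬ IsHarmonic I γ J := by
  obtain ⟨t, ht⟩ := hJ₀
  intro h
  have h1 := hγ.tension_eq hJ ht
  have h2 := hγ.inner_extFrame ht one_le_two one_le_two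
  rw [h t ht, extCurv_of_lt le_rfl (by omega)] at h1
  rw [(smul_eq_zero.1 h1.symm).resolve_left (hγ.curvature_pos 1 le_rfl (by omega) t ht).ne',
    inner_zero_left, if_pos ⟨rfl, hr⟩] at h2
  exact zero_ne_one h2

lemma isHarmonic (hγ : IsFrenetCurve I γ J 1 e κ) (hJ : IsOpen J) : IsHarmonic I γ J := by
  intro t ht
  rw [hγ.tension_eq hJ ht, extCurv_of_le le_rfl, Pi.zero_apply, zero_smul]

end IsFrenetCurve
end Frenet

/-! ### The bitension field of a Legendre curve -/

section LegendreFrenet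

variable {E : Type*} [NormedAddCommGroup E] [NormedSpace ℝ E] [FiniteDimensional ℝ E]
  {H : Type*} [TopologicalSpace H] {I : ModelWithCorners ℝ E H} [I.Boundaryless]
  {M : Type*} [TopologicalSpace M] [T2Space M] [ChartedSpace H M] [IsManifold I ∞ M]
  [RiemannianBundle (fun x : M => TangentSpace I x)]
  [IsContMDiffRiemannianBundle I ∞ E (fun x : M => TangentSpace I x)]
  {S : ContactMetricStructure I M}
  {γ : ℝ → M} {J : Set ℝ} {r : ℕ} {e : ℕ → Π t : ℝ, TangentSpace I (γ t)} {κ : ℕ → ℝ → ℝ} {t : ℝ}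

namespace ContactMetricStructure.IsSasakian

lemma inner_φ_self (hS : S.IsSasakian) (p : M) (v : TangentSpace I p) :
    (inner ℝ v (S.φ p v) : ℝ) = 0 := by
  have := hS.φ_skew p v v
  rw [real_inner_comm] at this
  linarith

/-- Derivative of an identity `⟨V, ξ⟩ = 0` along a curve. -/
lemma inner_covDerivAlong_ξ (hS : S.IsSasakian) {V : Π t : ℝ, TangentSpace I (γ t)}
    (hV : DiffAlongAt I γ V t) (h : ∀ᶠ s in nhds t, S.η (γ s) (V s) = 0) :
    S.η (γ t) (covDerivAlong I γ V t) = inner ℝ (V t) (S.φ (γ t) (velocity I γ t)) := by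
  have h1 := hasDerivAt_inner hV (hS.diffAlongAt_ξ hV.base).1
  have h2 : (fun s => (inner ℝ (V s) (S.ξ (γ s)) : ℝ)) =ᶠ[nhds t] fun _ => 0 := by
    filter_upwards [h] with s hs
    rw [hS.inner_ξ, hs]
  have h3 := h1.deriv
  rw [h2.deriv_eq, deriv_const, (hS.diffAlongAt_ξ hV.base).2, hS.inner_ξ, inner_neg_right] at h3
  linarith

end ContactMetricStructure.IsSasakian

namespace IsFrenetCurve

/-- Differentiating $\langle T,\xi\rangle=0$ gives $\eta(\nabla_TT)=\langle T,\varphi T\rangle=0$.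
-/
lemma η_tension (hγ : IsFrenetCurve I γ J r e κ) (hJ : IsOpen J) (hS : S.IsSasakian)
    (hL : S.IsLegendre γ J) (ht : t ∈ J) : S.η (γ t) (tension I γ t) = 0 := by
  have hV : DiffAlongAt I γ (velocity I γ) t := by
    refine (hγ.diffAlongAt hJ ht le_rfl).congr ?_
    filter_upwards [hJ.mem_nhds ht] with s hs using (hγ.extFrame_one hs).symm
  rw [tension, hS.inner_covDerivAlong_ξ hV, hS.inner_φ_self]
  filter_upwards [hJ.mem_nhds ht] with s hs using hL s hs

/-- The bitension field of a Legendre Frenet curve with `∇_T T ⟂ φT` in a Sasakian space form. -/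
lemma bitension_eq (hγ : IsFrenetCurve I γ J r e κ) (hJ : IsOpen J) {c : ℝ}
    (hS : S.IsSasakianSpaceForm c) (hL : S.IsLegendre γ J) (ht : t ∈ J)
    (hperp : inner ℝ (tension I γ t) (S.φ (γ t) (velocity I γ t)) = (0 : ℝ)) :
    bitension I γ t =
      (-(3 * extCurv r κ 1 t * deriv (extCurv r κ 1) t)) • extFrame r e 1 t
        + (deriv (deriv (extCurv r κ 1)) t
          - extCurv r κ 1 t * (extCurv r κ 1 t ^ 2 + extCurv r κ 2 t ^ 2 - (c + 3) / 4)) •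
            extFrame r e 2 t
        + (2 * deriv (extCurv r κ 1) t * extCurv r κ 2 t
          + extCurv r κ 1 t * deriv (extCurv r κ 2) t) • extFrame r e 3 t
        + (extCurv r κ 1 t * extCurv r κ 2 t * extCurv r κ 3 t) • extFrame r e 4 t := by
  have hT : inner ℝ (tension I γ t) (velocity I γ t) = (0 : ℝ) := by
    rw [hγ.tension_eq hJ ht, ← hγ.extFrame_one ht, inner_smul_left,
      hγ.inner_extFrame ht one_le_two le_rfl, if_neg (by omega), mul_zero]
  -- The space form enters only here: $-R(T,\kappa_1E_2)T=\frac{c+3}{4}\kappa_1E_2$ modifies just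
  -- the $E_2$-component.
  rw [bitension, hS.curvature_eq (hγ.inner_velocity ht) (hL t ht) (hγ.η_tension hJ hS.1 hL ht) hT
    hperp, hγ.covDerivAlong_covDerivAlong_tension hJ ht, hγ.tension_eq hJ ht]
  module

/-- A Legendre Frenet curve of osculating order at most 3 with `∇_T T ⟂ φT` is biharmonic if its
curvatures are constant with `κ₁ = 0` or `κ₁² + κ₂² = (c + 3) / 4`. -/
lemma bitension_eq_zero (hγ : IsFrenetCurve I γ J r e κ) (hJ : IsOpen J) {c k₁ k₂ : ℝ}
    (hS : S.IsSasakianSpaceForm c) (hL : S.IsLegendre γ J)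
    (hperp : ∀ t ∈ J, inner ℝ (tension I γ t) (S.φ (γ t) (velocity I γ t)) = (0 : ℝ))
    (hr : r ≤ 3) (h1 : ∀ t ∈ J, extCurv r κ 1 t = k₁) (h2 : ∀ t ∈ J, extCurv r κ 2 t = k₂)
    (hk : k₁ * (k₁ ^ 2 + k₂ ^ 2 - (c + 3) / 4) = 0) : IsBiharmonic I γ J := by
  intro t ht
  have hd : ∀ {f : ℝ → ℝ} {a : ℝ}, (∀ t ∈ J, f t = a) → ∀ t ∈ J, deriv f t = 0 := by
    intro f a h t ht
    have : f =ᶠ[nhds t] fun _ => a := by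
      filter_upwards [hJ.mem_nhds ht] with s hs using h s hs
    rw [this.deriv_eq, deriv_const]
  rw [hγ.bitension_eq hJ hS hL ht (hperp t ht), hd h1 t ht, hd h2 t ht, hd (hd h1) t ht, h1 t ht,
    h2 t ht, hk, extCurv_of_le hr]
  simp

lemma exists_const_of_deriv_eq_zero {J : Set ℝ} (hJ : IsOpen J) (hJ' : J.OrdConnected)
    (hJ₀ : J.Nonempty) {f : ℝ → ℝ} (hf : DifferentiableOn ℝ f J) (h : ∀ t ∈ J, deriv f t = 0) :
    ∃ a, ∀ t ∈ J, f t = a := by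
  obtain ⟨t₀, ht₀⟩ := hJ₀
  exact ⟨f t₀, fun t ht => hJ.is_const_of_deriv_eq_zero hJ'.isPreconnected hf h ht ht₀⟩

/-- Pair the bitension field with $E_1,\dots,E_4$. The $E_1$-component is $-3\kappa_1\kappa_1'$, so
$\kappa_1'=0$; then $E_2$ gives the quadratic relation, $E_3$ gives $\kappa_2'=0$, and $E_4$ gives
$\kappa_1\kappa_2\kappa_3=0$, impossible if $r\ge4$. -/
lemma curvatures_of_isBiharmonic (hγ : IsFrenetCurve I γ J r e κ) (hJ : IsOpen J) {c : ℝ}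
    (hS : S.IsSasakianSpaceForm c) (hL : S.IsLegendre γ J)
    (hperp : ∀ t ∈ J, inner ℝ (tension I γ t) (S.φ (γ t) (velocity I γ t)) = (0 : ℝ))
    (hr : 2 ≤ r) (hb : IsBiharmonic I γ J) (ht : t ∈ J) :
    deriv (extCurv r κ 1) t = 0 ∧ extCurv r κ 1 t ^ 2 + extCurv r κ 2 t ^ 2 = (c + 3) / 4 ∧
      deriv (extCurv r κ 2) t = 0 ∧ r ≤ 3 := by
  have hpos : ∀ t ∈ J, 0 < extCurv r κ 1 t := by
    intro t ht
    rw [extCurv_of_lt le_rfl (by omega)]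
    exact hγ.curvature_pos 1 le_rfl (by omega) t ht
  have key : ∀ t ∈ J, ∀ i, (inner ℝ (bitension I γ t) (extFrame r e i t) : ℝ) = 0 := by
    intro t ht i
    rw [hb t ht, inner_zero_left]
  have hd1 : ∀ t ∈ J, deriv (extCurv r κ 1) t = 0 := by
    intro t ht
    have h := key t ht 1
    rw [hγ.bitension_eq hJ hS hL ht (hperp t ht)] at h
    simp only [inner_add_left, inner_smul_left, hγ.inner_extFrame ht, Nat.one_le_ofNat, le_rfl,
      hγ.one_le] at h
    simp at h
    exact h.resolve_left (hpos t ht).ne'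
  have hdd : deriv (deriv (extCurv r κ 1)) t = 0 := by
    have : deriv (extCurv r κ 1) =ᶠ[nhds t] fun _ => 0 := by
      filter_upwards [hJ.mem_nhds ht] with s hs using hd1 s hs
    rw [this.deriv_eq, deriv_const]
  have hB := hγ.bitension_eq hJ hS hL ht (hperp t ht)
  rw [hd1 t ht, hdd] at hB
  have h2 := key t ht 2
  have h3 := key t ht 3
  have h4 := key t ht 4
  rw [hB] at h2 h3 h4
  simp only [inner_add_left, inner_smul_left, hγ.inner_extFrame ht, Nat.one_le_ofNat, le_rfl,
    hr] at h2 h3 h4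
  simp [(hpos t ht).ne'] at h2 h3 h4
  refine ⟨hd1 t ht, by linarith, ?_, ?_⟩
  · rcases le_or_gt 3 r with h | h
    · exact h3 h
    -- For `r = 2` there is no $E_3$-component, but the extended $\kappa_2$ is identically zero.
    · rw [extCurv_of_le (by omega), Pi.zero_def, deriv_const]
  · by_contra! h
    rcases h4 h with h4 | h4
    · rw [extCurv_of_lt (by omega) (by omega)] at h4
      exact (hγ.curvature_pos 2 (by omega) (by omega) t ht).ne' h4
    · rw [extCurv_of_lt (by omega) (by omega)] at h4
      exact (hγ.curvature_pos 3 (by omega) (by omega) t ht).ne' h4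

end IsFrenetCurve
end LegendreFrenet

/-! ### Dimension bounds -/

section Dimension

variable {E : Type*} [NormedAddCommGroup E] [NormedSpace ℝ E] [FiniteDimensional ℝ E]
  {H : Type*} [TopologicalSpace H] {I : ModelWithCorners ℝ E H} [I.Boundaryless]
  {M : Type*} [TopologicalSpace M] [T2Space M] [ChartedSpace H M] [IsManifold I ∞ M]
  [RiemannianBundle (fun x : M => TangentSpace I x)]
  [IsContMDiffRiemannianBundle I ∞ E (fun x : M => TangentSpace I x)]
  {S : ContactMetricStructure I M}
  {γ : ℝ → M} {J : Set ℝ} {r : ℕ} {e : ℕ → Π t : ℝ, TangentSpace I (γ t)} {κ : ℕ → ℝ → ℝ} {t : ℝ}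

namespace ContactMetricStructure.IsSasakian

/-- If `T`, `u` are orthonormal horizontal vectors with `u ⟂ φT`, then `u`, `T`, `φT`, `ξ` are
orthonormal. -/
lemma orthonormal_four (hS : S.IsSasakian) {p : M} {T u : TangentSpace I p}
    (hT : inner ℝ T T = (1 : ℝ)) (hu : inner ℝ u u = (1 : ℝ)) (hηT : S.η p T = 0)
    (hηu : S.η p u = 0) (huT : inner ℝ u T = (0 : ℝ)) (huφT : inner ℝ u (S.φ p T) = (0 : ℝ)) :
    Orthonormal ℝ ![u, T, S.φ p T, S.ξ p] := by
  have norm_eq : ∀ {v : TangentSpace I p}, inner ℝ v v = (1 : ℝ) → ‖v‖ = 1 := by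
    intro v hv
    rw [norm_eq_sqrt_real_inner, hv, Real.sqrt_one]
  have hφT : ‖S.φ p T‖ = 1 := norm_eq (by rw [S.inner_φ_φ, hT, hηT]; ring)
  have hξ : ‖S.ξ p‖ = 1 := norm_eq (by rw [hS.inner_ξ, S.η_ξ])
  simp only [orthonormal_vecCons_iff, Fin.forall_fin_succ, norm_eq hT, norm_eq hu, hφT, hξ,
    Matrix.cons_val_zero, Matrix.cons_val_succ, huT, huφT, hS.inner_ξ, hS.η_φ, hηT, hηu,
    hS.inner_φ_self, IsEmpty.forall_iff, and_self, true_and]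
  exact ⟨by simp, fun i => i.elim0⟩

/-- If moreover `w` is a horizontal unit vector orthogonal to `T`, `φT`, `u`, `φu`, then `w`, `φu`,
`u`, `T`, `φT`, `ξ` are orthonormal. -/
lemma orthonormal_six (hS : S.IsSasakian) {p : M} {T u w : TangentSpace I p}
    (hT : inner ℝ T T = (1 : ℝ)) (hu : inner ℝ u u = (1 : ℝ)) (hw : inner ℝ w w = (1 : ℝ))
    (hηT : S.η p T = 0) (hηu : S.η p u = 0) (hηw : S.η p w = 0)
    (huT : inner ℝ u T = (0 : ℝ)) (huφT : inner ℝ u (S.φ p T) = (0 : ℝ))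
    (hwT : inner ℝ w T = (0 : ℝ)) (hwφT : inner ℝ w (S.φ p T) = (0 : ℝ))
    (hwu : inner ℝ w u = (0 : ℝ)) (hwφu : inner ℝ w (S.φ p u) = (0 : ℝ)) :
    Orthonormal ℝ ![w, S.φ p u, u, T, S.φ p T, S.ξ p] := by
  have norm_eq : ∀ {v : TangentSpace I p}, inner ℝ v v = (1 : ℝ) → ‖v‖ = 1 := by
    intro v hv
    rw [norm_eq_sqrt_real_inner, hv, Real.sqrt_one]
  have hφu : ‖S.φ p u‖ = 1 := norm_eq (by rw [S.inner_φ_φ, hu, hηu]; ring)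
  have hφuu : (inner ℝ (S.φ p u) u : ℝ) = 0 := by rw [hS.φ_skew, hS.inner_φ_self, neg_zero]
  have hφuT : (inner ℝ (S.φ p u) T : ℝ) = 0 := by rw [hS.φ_skew, huφT, neg_zero]
  have hφuφT : (inner ℝ (S.φ p u) (S.φ p T) : ℝ) = 0 := by
    rw [S.inner_φ_φ, huT, hηu, zero_mul, sub_zero]
  rw [orthonormal_vecCons_iff, orthonormal_vecCons_iff]
  refine ⟨norm_eq hw, ?_, hφu, ?_, hS.orthonormal_four hT hu hηT hηu huT huφT⟩ <;>
  simp only [Fin.forall_fin_succ, Matrix.cons_val_zero, Matrix.cons_val_succ, hwT, hwφT, hwu, hwφu,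
    hφuu, hφuT, hφuφT, hS.inner_ξ, hS.η_φ, hηw, IsEmpty.forall_iff, and_self]

end ContactMetricStructure.IsSasakian

namespace IsFrenetCurve

lemma η_extFrame_two (hγ : IsFrenetCurve I γ J r e κ) (hJ : IsOpen J) (hS : S.IsSasakian)
    (hL : S.IsLegendre γ J) (ht : t ∈ J) : S.η (γ t) (extFrame r e 2 t) = 0 := by
  rcases le_or_gt 2 r with h | h
  · have h1 := hγ.η_tension hJ hS hL ht
    rw [hγ.tension_eq hJ ht, map_smul, extCurv_of_lt le_rfl (by omega), smul_eq_mul] at h1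
    exact (mul_eq_zero.1 h1).resolve_left (hγ.curvature_pos 1 le_rfl (by omega) t ht).ne'
  · rw [extFrame_of_lt h, Pi.zero_apply, map_zero]

lemma four_le_finrank (hγ : IsFrenetCurve I γ J r e κ) (hJ : IsOpen J) (hS : S.IsSasakian)
    (hL : S.IsLegendre γ J) (hr : 2 ≤ r) (ht : t ∈ J)
    (hperp : inner ℝ (extFrame r e 2 t) (S.φ (γ t) (velocity I γ t)) = (0 : ℝ)) :
    4 ≤ Module.finrank ℝ E := by
  have h := hS.orthonormal_four (hγ.inner_velocity ht) (u := extFrame r e 2 t)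
    (by rw [hγ.inner_extFrame ht one_le_two one_le_two, if_pos ⟨rfl, hr⟩]) (hL t ht)
    (hγ.η_extFrame_two hJ hS hL ht)
    (by rw [← hγ.extFrame_one ht, hγ.inner_extFrame ht one_le_two le_rfl, if_neg (by omega)])
    hperp
  have := h.linearIndependent.fintype_card_le_finrank
  rwa [Fintype.card_fin] at this

/-- Successive differentiation produces the missing orthogonality relations: $\eta(E_2)=0$ yields
$\eta(E_3)=0$, $\langle E_2,\varphi T\rangle=0$ yields $\langle E_3,\varphi T\rangle=0$, and this in
turn yields $\langle E_3,\varphi E_2\rangle=0$. Each time one divides by $\kappa_1$ or $\kappa_2$.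
-/
lemma six_le_finrank (hγ : IsFrenetCurve I γ J 3 e κ) (hJ : IsOpen J) (hS : S.IsSasakian)
    (hL : S.IsLegendre γ J) (ht : t ∈ J)
    (hperp : ∀ t ∈ J, inner ℝ (extFrame 3 e 2 t) (S.φ (γ t) (velocity I γ t)) = (0 : ℝ)) :
    6 ≤ Module.finrank ℝ E := by
  have h2pos : ∀ t ∈ J, extCurv 3 κ 2 t ≠ 0 := by
    intro t ht
    rw [extCurv_of_lt (by omega) (by omega)]
    exact (hγ.curvature_pos 2 (by omega) (by omega) t ht).ne'
  have h1pos : ∀ t ∈ J, extCurv 3 κ 1 t ≠ 0 := by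
    intro t ht
    rw [extCurv_of_lt (by omega) (by omega)]
    exact (hγ.curvature_pos 1 (by omega) (by omega) t ht).ne'
  have hV : ∀ t ∈ J, DiffAlongAt I γ (velocity I γ) t := by
    intro t ht
    refine (hγ.diffAlongAt hJ ht le_rfl).congr ?_
    filter_upwards [hJ.mem_nhds ht] with s hs using (hγ.extFrame_one hs).symm
  have hinner : ∀ t ∈ J, ∀ i, 2 ≤ i →
      (inner ℝ (extFrame 3 e i t) (velocity I γ t) : ℝ) = 0 := by
    intro t ht i hi
    rw [← hγ.extFrame_one ht, hγ.inner_extFrame ht (by omega) le_rfl, if_neg (by omega)]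
  have hη3 : S.η (γ t) (extFrame 3 e 3 t) = 0 := by
    have h := hS.inner_covDerivAlong_ξ (hγ.diffAlongAt hJ ht one_le_two) (by
      filter_upwards [hJ.mem_nhds ht] with s hs using hγ.η_extFrame_two hJ hS hL hs)
    rw [hγ.covDerivAlong_extFrame hJ ht one_le_two, hperp t ht, map_add, map_neg, map_smul,
      map_smul, show 2 - 1 = 1 from rfl, hγ.extFrame_one ht, hL t ht, smul_zero, neg_zero, zero_add, smul_eq_mul] at h
    exact (mul_eq_zero.1 h).resolve_left (h2pos t ht)
  -- Derivative of $\langle E_i,\varphi T\rangle=0$, using $\nabla_T(\varphi T)=\xi+\kappa_1\varphi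
  -- E_2$.
  have hderiv : ∀ t ∈ J, ∀ i, 1 ≤ i → (∀ s ∈ J,
      inner ℝ (extFrame 3 e i s) (S.φ (γ s) (velocity I γ s)) = (0 : ℝ)) →
      (inner ℝ (covDerivAlong I γ (extFrame 3 e i) t) (S.φ (γ t) (velocity I γ t)) : ℝ)
        + (S.η (γ t) (extFrame 3 e i t)
        + extCurv 3 κ 1 t * inner ℝ (extFrame 3 e i t) (S.φ (γ t) (extFrame 3 e 2 t))) = 0 := by
    intro t ht i hi h0
    have h := (hasDerivAt_inner (hγ.diffAlongAt hJ ht hi) (hS.diffAlongAt_φ (hV t ht))).deriv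
    have h' : (fun s => (inner ℝ (extFrame 3 e i s) (S.φ (γ s) (velocity I γ s)) : ℝ))
        =ᶠ[nhds t] fun _ => 0 := by
      filter_upwards [hJ.mem_nhds ht] with s hs using h0 s hs
    rw [h'.deriv_eq, deriv_const, hS.covDerivAlong_φ (hV t ht), hγ.inner_velocity ht, hL t ht,
      ← tension, hγ.tension_eq hJ ht, zero_smul, sub_zero, one_smul, map_smul, inner_add_right,
      inner_smul_right, hS.inner_ξ] at h
    exact h.symm
  have h3φ : ∀ t ∈ J, (inner ℝ (extFrame 3 e 3 t) (S.φ (γ t) (velocity I γ t)) : ℝ) = 0 := by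
    intro t ht
    have h := hderiv t ht 2 one_le_two hperp
    rw [hγ.covDerivAlong_extFrame hJ ht one_le_two, hγ.η_extFrame_two hJ hS hL ht,
      hS.inner_φ_self, inner_add_left, inner_neg_left, inner_smul_left, inner_smul_left,
      show 2 - 1 = 1 from rfl, hγ.extFrame_one ht, hS.inner_φ_self] at h
    simp only [mul_zero, neg_zero, zero_add, add_zero] at h
    exact (mul_eq_zero.1 h).resolve_left (h2pos t ht)
  have h3φ2 : (inner ℝ (extFrame 3 e 3 t) (S.φ (γ t) (extFrame 3 e 2 t)) : ℝ) = 0 := by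
    -- Since the order is exactly 3, $\nabla_TE_3=-\kappa_2E_2$, whose product with $\varphi T$
    -- vanishes; only $\kappa_1\langle E_3,\varphi E_2\rangle$ survives.
    have h := hderiv t ht 3 (by omega) h3φ
    rw [hγ.covDerivAlong_extFrame hJ ht (by omega), hη3, extCurv_of_le le_rfl, inner_add_left,
      inner_neg_left, inner_smul_left, inner_smul_left, hperp t ht] at h
    simp only [Pi.zero_apply, map_zero, zero_mul, mul_zero, neg_zero, zero_add] at h
    exact (mul_eq_zero.1 h).resolve_left (h1pos t ht)
  have h := hS.orthonormal_six (hγ.inner_velocity ht) (u := extFrame 3 e 2 t)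
    (w := extFrame 3 e 3 t)
    (by rw [hγ.inner_extFrame ht one_le_two one_le_two, if_pos (by omega)])
    (by rw [hγ.inner_extFrame ht (by omega) (by omega), if_pos (by omega)]) (hL t ht)
    (hγ.η_extFrame_two hJ hS hL ht) hη3 (hinner t ht 2 le_rfl) (hperp t ht)
    (hinner t ht 3 (by omega)) (h3φ t ht)
    (by rw [hγ.inner_extFrame ht (by omega) (by omega), if_neg (by omega)]) h3φ2
  have := h.linearIndependent.fintype_card_le_finrank
  rwa [Fintype.card_fin] at this

end IsFrenetCurve
end Dimension
end RiemGeom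

/-! ### The classification -/

theorem mainTheorem2 (n : ℕ) {N : Type*} [TopologicalSpace N] [T2Space N]
    [SecondCountableTopology N] [ChartedSpace (EuclideanSpace ℝ (Fin (2 * n + 1))) N]
    [IsManifold (𝓡 (2 * n + 1)) ∞ N]
    [RiemannianBundle (fun x : N => TangentSpace (𝓡 (2 * n + 1)) x)]
    [IsContMDiffRiemannianBundle (𝓡 (2 * n + 1)) ∞ (EuclideanSpace ℝ (Fin (2 * n + 1)))
      (fun x : N => TangentSpace (𝓡 (2 * n + 1)) x)]
    (S : ContactMetricStructure (𝓡 (2 * n + 1)) N) (c : ℝ) (hS : S.IsSasakianSpaceForm c)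
    (J : Set ℝ) (hJ_open : IsOpen J) (hJ_interval : J.OrdConnected) (hJ_nonempty : J.Nonempty)
    (γ : ℝ → N) (r : ℕ) (e : ℕ → Π t : ℝ, TangentSpace (𝓡 (2 * n + 1)) (γ t)) (κ : ℕ → ℝ → ℝ)
    (hγ : IsFrenetCurve (𝓡 (2 * n + 1)) γ J r e κ) (hLegendre : S.IsLegendre γ J)
    (hc : c ≠ 1)
    (hperp : 2 ≤ r → ∀ t ∈ J,
      inner ℝ (e 2 t) (S.φ (γ t) (velocity (𝓡 (2 * n + 1)) γ t)) = (0 : ℝ)) :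
    (c ≤ -3 → (IsBiharmonic (𝓡 (2 * n + 1)) γ J ↔ IsGeodesic (𝓡 (2 * n + 1)) γ J)) ∧
    (-3 < c →
      (IsProperBiharmonic (𝓡 (2 * n + 1)) γ J ↔
        (2 ≤ n ∧ ∃ k₁ : ℝ, IsCircle (𝓡 (2 * n + 1)) γ J k₁ ∧ k₁ ^ 2 = (c + 3) / 4) ∨
        (3 ≤ n ∧ ∃ k₁ k₂ : ℝ, IsHelix (𝓡 (2 * n + 1)) γ J k₁ k₂ ∧
          k₁ ^ 2 + k₂ ^ 2 = (c + 3) / 4))) := by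
  -- Stated for $\nabla_TT$ instead of $E_2$, the orthogonality no longer depends on the frame, so
  -- it applies to any frame witnessing that $\gamma$ is a geodesic, circle or helix.
  have hperp' : ∀ t ∈ J, inner ℝ (tension (𝓡 (2 * n + 1)) γ t)
      (S.φ (γ t) (velocity (𝓡 (2 * n + 1)) γ t)) = (0 : ℝ) :=
    fun t ht => hγ.inner_tension_eq_zero hJ_open ht fun hr => hperp hr t ht
  have hgeod : ∀ {e κ}, IsFrenetCurve (𝓡 (2 * n + 1)) γ J 1 e κ →
      IsBiharmonic (𝓡 (2 * n + 1)) γ J := by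
    intro e κ h
    refine h.bitension_eq_zero hJ_open (k₁ := 0) (k₂ := 0) hS hLegendre hperp' (by omega) ?_ ?_
      (zero_mul _) <;> intro t _ <;> rw [extCurv_of_le (by omega), Pi.zero_apply]
  refine ⟨fun hc3 => ⟨fun hb => ?_, fun ⟨e', κ', h⟩ => hgeod h⟩,
    fun hc3 => ⟨fun ⟨hb, hnh⟩ => ?_, ?_⟩⟩
  · rcases le_or_gt 2 r with hr | hr
    · obtain ⟨t, ht⟩ := hJ_nonempty
      have h1 := (hγ.curvatures_of_isBiharmonic hJ_open hS hLegendre hperp' hr hb ht).2.1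
      have h2 := hγ.curvature_pos 1 le_rfl (by omega) t ht
      rw [extCurv_of_lt le_rfl (by omega)] at h1
      -- $\kappa_1^2+\kappa_2^2=\frac{c+3}{4}\le0$ contradicts $\kappa_1>0$.
      nlinarith [sq_nonneg (extCurv r κ 2 t)]
    · obtain rfl : r = 1 := by have := hγ.one_le; omega
      exact ⟨e, κ, hγ⟩
  · have hr : 2 ≤ r := by
      by_contra! hr
      obtain rfl : r = 1 := by have := hγ.one_le; omega
      exact hnh (hγ.isHarmonic hJ_open)
    have key := fun t (ht : t ∈ J) =>
      hγ.curvatures_of_isBiharmonic hJ_open hS hLegendre hperp' hr hb ht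
    have hconst : ∀ i, (∀ t ∈ J, deriv (extCurv r κ i) t = 0) →
        ∃ a, ∀ t ∈ J, extCurv r κ i t = a := fun i h =>
      IsFrenetCurve.exists_const_of_deriv_eq_zero hJ_open hJ_interval hJ_nonempty
        ((hγ.contDiffOn_extCurv i).differentiableOn (by simp)) h
    obtain ⟨k₁, h1⟩ := hconst 1 fun t ht => (key t ht).1
    obtain ⟨k₂, h2⟩ := hconst 2 fun t ht => (key t ht).2.2.1
    obtain ⟨t, ht⟩ := hJ_nonempty
    have hperp2 : ∀ t ∈ J, inner ℝ (extFrame r e 2 t)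
        (S.φ (γ t) (velocity (𝓡 (2 * n + 1)) γ t)) = (0 : ℝ) := by
      intro t ht
      rw [extFrame_of_le hr, hperp hr t ht]
    have hk := (key t ht).2.1
    rw [h1 t ht, h2 t ht] at hk
    obtain rfl | rfl : r = 2 ∨ r = 3 := by have := (key t ht).2.2.2; omega
    · refine Or.inl ⟨?_, k₁, ⟨e, κ, hγ, fun t ht => ?_⟩, ?_⟩
      · have := hγ.four_le_finrank hJ_open hS.1 hLegendre hr ht (hperp2 t ht)
        rw [finrank_euclideanSpace_fin] at this
        omega
      · rw [← h1 t ht, extCurv_of_lt le_rfl (by omega)]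
      -- In order 2 the extended $\kappa_2$ vanishes, so the relation reduces to
      -- $\kappa_1^2=\frac{c+3}{4}$.
      · have h0 := h2 t ht
        rw [extCurv_of_le le_rfl, Pi.zero_apply] at h0
        rw [← hk, ← h0]
        ring
    · refine Or.inr ⟨?_, k₁, k₂, ⟨e, κ, hγ, fun t ht => ⟨?_, ?_⟩⟩, hk⟩
      · have := hγ.six_le_finrank hJ_open hS.1 hLegendre ht hperp2
        rw [finrank_euclideanSpace_fin] at this
        omega
      · rw [← h1 t ht, extCurv_of_lt le_rfl (by omega)]
      · rw [← h2 t ht, extCurv_of_lt (by omega) (by omega)]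
  -- The bounds on `n` are consequences of biharmonicity and play no role in this direction.
  · rintro (⟨-, k₁, ⟨e', κ', h, h1⟩, hk⟩ | ⟨-, k₁, k₂, ⟨e', κ', h, h12⟩, hk⟩)
    · refine ⟨h.bitension_eq_zero hJ_open (k₁ := k₁) (k₂ := 0) hS hLegendre hperp' (by omega) ?_
        ?_ (by rw [hk]; ring), h.not_isHarmonic hJ_open hJ_nonempty le_rfl⟩ <;> intro t ht
      · rw [extCurv_of_lt le_rfl (by omega), h1 t ht]
      · rw [extCurv_of_le le_rfl, Pi.zero_apply]
    · refine ⟨h.bitension_eq_zero hJ_open (k₁ := k₁) (k₂ := k₂) hS hLegendre hperp' le_rfl ?_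
        ?_ (by rw [hk]; ring), h.not_isHarmonic hJ_open hJ_nonempty (by omega)⟩ <;> intro t ht
      · rw [extCurv_of_lt le_rfl (by omega), (h12 t ht).1]
      · rw [extCurv_of_lt (by omega) (by omega), (h12 t ht).2]
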